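/- Let $X$ be a one-dimensional complex manifold, let $f\colon X\to\mathbb{C}$ be a holomorphic function all of whose critical points are non-degenerate, and let $\nu$ be a holomorphic $1$-form on $X$. Let $a$ be a critical point of $f$, put $\alpha=f(a)$, and let $\theta\in\mathbb{R}$. Let $\mathcal{C}=\mathcal{C}_a^\theta$ be the Lefschetz thimble through $a$ in direction $\theta$: the connected component containing $a$ of $f^{-1}(\alpha+e^{i\theta}[0,\infty))$, with a chosen orientation, where it is assumed that $a$ is the only critical point of $f$ on $\mathcal{C}$ and that both halves of $\mathcal{C}$ starting at $a$ run out to infinity along the ray (so $\mathcal{C}$ is the image of an injective regular $C^1$ curve $\gamma\colon\mathbb{R}\to X$ with $\gamma(0)=a$ and $|f(\gamma(s))|\to\infty$ as $s\to\pm\infty$, which induces the orientation). Put $$I_a(z)=\int_{\mathcal{C}}e^{-zf}\,\nu,$$ let $D$ be the set of all $z\in\mathbb{C}$ at which this integral converges absolutely, and suppose that $D\neq\emptyset$. Below, fractional powers of $z$ are taken with the branch of $\arg z$ that equals $-\theta$ on the ray $e^{-i\theta}(0,\infty)$, and fractional powers of $\zeta-\alpha$ with the branch of $\arg(\zeta-\alpha)$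 that equals $\theta$ on the ray $\alpha+e^{i\theta}(0,\infty)$. Then $I_a$ is Borel regular. That is: 1. $I_a$ has an asymptotic expansion in the direction $-\theta$ in the space $e^{-z\alpha}z^{-1/2}\,\mathbb{C}[[z^{-1}]]$: there are $c_0,c_1,\dots\in\mathbb{C}$ and an open sector $S=\{\rho e^{i(-\theta+\psi)} : \rho>R,\ |\psi|<\delta\}\subseteq D$ (with $R>0$ and $0<\delta\le\pi$) such that $I_a$ is holomorphic on $S$ and, for every $n\ge 0$, $$I_a(z)-e^{-z\alpha}\sum_{k=0}^{n}c_k z^{-1/2-k}=o\big(e^{-z\alpha}z^{-1/2-n}\big)$$ as $z\to\infty$ along each ray of $S$. 2. For this expansion (that is, for every sequence $(c_n)$ as in 1), the Borel transform $$\tilde\iota_a=\sum_{n\ge 0}\frac{c_n}{\Gamma(n+\frac12)}\,(\zeta-\alpha)^{n-1/2}$$ converges near $\zeta=\alpha$: the power series $\sum_n \frac{c_n}{\Gamma(n+1/2)}x^n$ has a positive radius of convergence. 3. The sum of $\tilde\iota_a$ continues analytically along the ray $\alpha+e^{i\theta}(0,\infty)$: there is a holomorphic function $\iota_a$ on an open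 set that contains this ray and a half-disk $\{|\zeta-\alpha|<r,\ \mathrm{Re}(e^{-i\theta}(\zeta-\alpha))>0\}$, equal on the half-disk to the sum of $\tilde\iota_a$. Moreover, for every $z\in D$ its Laplace integral along the ray converges absolutely, and $$\int_{\alpha+e^{i\theta}(0,\infty)}e^{-z\zeta}\,\iota_a(\zeta)\,d\zeta=I_a(z).$$ -/

import Mathlib

open scoped Manifold
open MeasureTheory Filter

noncomputable section

namespace Thimble

/-! ### Rays, sectors, fractional powers -/

/-- The closed ray `{α + t e^{iθ} : t ≥ 0}`. -/
def ray (α : ℂ) (θ : ℝ) : Set ℂ :=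
  {ζ | ∃ t : ℝ, 0 ≤ t ∧ ζ = α + t * Complex.exp (θ * Complex.I)}

/-- The open ray `{α + t e^{iθ} : t > 0}`. -/
def openRay (α : ℂ) (θ : ℝ) : Set ℂ :=
  {ζ | ∃ t : ℝ, 0 < t ∧ ζ = α + t * Complex.exp (θ * Complex.I)}

/-- The open sector at infinity of half-opening `δ` around the direction `β`, truncated to
`|z| > R`. -/
def sectorAtInfty (β δ R : ℝ) : Set ℂ :=
  {z | ∃ ρ ψ : ℝ, R < ρ ∧ |ψ| < δ ∧ z = ρ * Complex.exp ((β + ψ : ℝ) * Complex.I)}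

/-- The branch of `u ↦ u ^ σ` determined by the (extended) direction `β`: for
`u = ρ e^{i(β + ψ)}` with `ρ > 0` and `|ψ| < π` it is `ρ ^ σ e^{i(β + ψ)σ}`. -/
def dirPow (β : ℝ) (u : ℂ) (σ : ℝ) : ℂ :=
  Complex.exp (β * σ * Complex.I) * (Complex.exp (-(β * Complex.I)) * u) ^ (σ : ℂ)

/-! ### Asymptotic expansions, Borel and Laplace transforms

The sequence `c` stands for the formal trans-monomial series
`e^{-αz} z^{-τ} ∑ c n z^{-n}`, an element of `e^{-αz} z^{-τ} ℂ⟦z⁻¹⟧`. -/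

/-- The function `Φ`, with domain `D`, is asymptotic to `e^{-αz} z^{-τ} ∑ c n z^{-n}` in the
direction `β`: on some open sector at infinity, contained in `D`, around the ray of direction `β`,
the function `Φ` is holomorphic and, along each ray of the sector, for every order `n`, the error
of the `n`-th partial sum is `o(e^{-αz} z^{-τ-n})`. Powers of `z` are those of direction `β`. -/
def HasAsymptoticExpansion (D : Set ℂ) (Φ : ℂ → ℂ) (β : ℝ) (α : ℂ) (τ : ℝ) (c : ℕ → ℂ) : Prop :=
  ∃ δ R : ℝ, 0 < δ ∧ δ ≤ Real.pi ∧ 0 < R ∧ sectorAtInfty β δ R ⊆ D ∧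
    DifferentiableOn ℂ Φ (sectorAtInfty β δ R) ∧
    ∀ ψ : ℝ, |ψ| < δ → ∀ n : ℕ,
      let z : ℝ → ℂ := fun ρ => ρ * Complex.exp ((β + ψ : ℝ) * Complex.I)
      (fun ρ : ℝ => Φ (z ρ) -
          Complex.exp (-(α * z ρ)) * ∑ k ∈ Finset.range (n + 1), c k * dirPow β (z ρ) (-τ - k))
        =o[atTop] (fun ρ : ℝ => Complex.exp (-(α * z ρ)) * dirPow β (z ρ) (-τ - n))

/-- The Borel transform of `e^{-αz} z^{-τ} ∑ c n z^{-n}` is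
`∑ (c n / Γ(τ + n)) (ζ - α)^{τ - 1 + n}`; this is its sequence of coefficients. -/
def borelCoeff (τ : ℝ) (c : ℕ → ℂ) (n : ℕ) : ℂ :=
  c n / (Real.Gamma (τ + n) : ℂ)

/-- The shifted power series `(ζ - α)^{τ - 1} ∑ b n (ζ - α)^n` converges near `α`: the power
series `∑ b n x^n` has a positive radius of convergence. -/
def ConvergesNearTip (b : ℕ → ℂ) : Prop :=
  ∃ r : ℝ, 0 < r ∧ Summable fun n => ‖b n‖ * r ^ n

/-- `φ` is, on `U`, an analytic continuation along the ray `α + e^{iθ}(0, ∞)` of the sum of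
`∑ b n (ζ - α)^{τ - 1 + n}`: the open set `U` contains the ray and a half-disk at `α` centred on
the ray, `φ` is holomorphic on `U`, and on the half-disk it is the sum of the series (powers of
`ζ - α` being those of direction `θ`). -/
def IsContinuationAlongRay (α : ℂ) (θ τ : ℝ) (b : ℕ → ℂ) (U : Set ℂ) (φ : ℂ → ℂ) : Prop :=
  IsOpen U ∧ openRay α θ ⊆ U ∧ DifferentiableOn ℂ φ U ∧
    ∃ r : ℝ, 0 < r ∧ ∀ ζ : ℂ, ‖ζ - α‖ < r →
      0 < (Complex.exp (-(θ * Complex.I)) * (ζ - α)).re →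
        ζ ∈ U ∧ HasSum (fun n : ℕ => b n * dirPow θ (ζ - α) (τ - 1 + n)) (φ ζ)

/-- The integrand of the Laplace transform of `φ` along the ray `α + e^{iθ}(0, ∞)`, in the
parameter `t` with `ζ = α + t e^{iθ}`, `dζ = e^{iθ} dt`. -/
def laplaceIntegrand (α : ℂ) (θ : ℝ) (φ : ℂ → ℂ) (z : ℂ) (t : ℝ) : ℂ :=
  Complex.exp (-(z * (α + t * Complex.exp (θ * Complex.I)))) *
    φ (α + t * Complex.exp (θ * Complex.I)) * Complex.exp (θ * Complex.I)

/-- The Laplace transform `∫ e^{-zζ} φ(ζ) dζ` along the ray `α + e^{iθ}(0, ∞)`. -/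
def laplace (α : ℂ) (θ : ℝ) (φ : ℂ → ℂ) (z : ℂ) : ℂ :=
  ∫ t in Set.Ioi (0 : ℝ), laplaceIntegrand α θ φ z t

/-- Borel regularity, in the direction `θ` and at the base point `α`, of a function `Φ` with
domain `D`, whose expansion is in the trans-monomial space `e^{-αz} z^{-τ} ℂ⟦z⁻¹⟧`. -/
structure IsBorelRegular (D : Set ℂ) (Φ : ℂ → ℂ) (θ : ℝ) (α : ℂ) (τ : ℝ) : Prop where
  /-- `Φ` has an asymptotic expansion, in the direction in which its Laplace integral decays. -/
  exists_expansion : ∃ c : ℕ → ℂ, HasAsymptoticExpansion D Φ (-θ) α τ c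
  /-- The Borel transform of the asymptotic expansion converges near `α`. -/
  borel_converges : ∀ c : ℕ → ℂ, HasAsymptoticExpansion D Φ (-θ) α τ c →
    ConvergesNearTip (borelCoeff τ c)
  /-- The sum continues analytically along the ray; its Laplace integral converges absolutely
  wherever `Φ` is defined, and gives back `Φ`. -/
  laplace_eq : ∀ c : ℕ → ℂ, HasAsymptoticExpansion D Φ (-θ) α τ c →
    ∃ (U : Set ℂ) (φ : ℂ → ℂ), IsContinuationAlongRay α θ τ (borelCoeff τ c) U φ ∧
      ∀ z ∈ D, IntegrableOn (laplaceIntegrand α θ φ z) (Set.Ioi 0) ∧ laplace α θ φ z = Φ z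

/-! ### Critical points, one-forms and thimbles on a one-dimensional complex manifold -/

section Manifold

variable {X : Type*} [TopologicalSpace X] [ChartedSpace ℂ X]

/-- `x` is a critical point of `f`. -/
def IsCriticalPoint (f : X → ℂ) (x : X) : Prop :=
  mfderiv 𝓘(ℂ) 𝓘(ℂ) f x = 0

/-- `x` is a non-degenerate critical point of `f`: the second derivative in a chart at `x` does
not vanish. -/
def IsNondegenerateCriticalPoint (f : X → ℂ) (x : X) : Prop :=
  IsCriticalPoint f x ∧
    iteratedDeriv 2 (f ∘ (extChartAt 𝓘(ℂ) x).symm) (extChartAt 𝓘(ℂ) x x) ≠ 0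

/-- A field `ν` of complex-linear forms on the tangent spaces is a holomorphic one-form: in each
chart it reads `g(w) dw` with `g` holomorphic. -/
def IsHolomorphicOneForm (ν : (x : X) → TangentSpace 𝓘(ℂ) x →L[ℂ] ℂ) : Prop :=
  ∀ x₀ : X, DifferentiableOn ℂ
    (fun w : ℂ => ν ((extChartAt 𝓘(ℂ) x₀).symm w)
      (mfderiv 𝓘(ℂ) 𝓘(ℂ) (extChartAt 𝓘(ℂ) x₀).symm w (1 : ℂ)))
    (extChartAt 𝓘(ℂ) x₀).target

/-- The connected component through `a` of the preimage of the ray that starts at `f a` in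
direction `θ`. -/
def thimble (f : X → ℂ) (a : X) (θ : ℝ) : Set X :=
  connectedComponentIn (f ⁻¹' ray (f a) θ) a

/-- The velocity of a curve in `X`, as a tangent vector. (The tangent spaces of `X` as a real and
as a complex manifold are the same space, with the same identification with `ℂ` through the
chart.) -/
def velocity (γ : ℝ → X) (s : ℝ) : TangentSpace 𝓘(ℂ) (γ s) :=
  (mfderiv 𝓘(ℝ, ℝ) 𝓘(ℝ, ℂ) γ s (1 : ℝ) : ℂ)

/-- The component through `a` of the preimage of the ray of direction `θ` is a Lefschetz thimble
`C`, and `γ : ℝ → X` is a regular parametrization of `C`, which also fixes its orientation: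
`a` is the only critical point on `C` and it is non-degenerate; `γ` is an injective `C¹` curve
with nowhere vanishing velocity, it passes through `a` at time `0` and its range is `C`;
both halves of `C` run out to infinity along the ray. -/
structure IsOrientedThimble (f : X → ℂ) (a : X) (θ : ℝ) (γ : ℝ → X) : Prop where
  nondegenerate : IsNondegenerateCriticalPoint f a
  eq_of_critical : ∀ x ∈ thimble f a θ, IsCriticalPoint f x → x = a
  contMDiff : ContMDiff 𝓘(ℝ, ℝ) 𝓘(ℝ, ℂ) 1 γ
  velocity_ne_zero : ∀ s, velocity γ s ≠ 0
  injective : Function.Injective γ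
  map_zero : γ 0 = a
  range_eq : Set.range γ = thimble f a θ
  tendsto_future : Tendsto (fun s => ‖f (γ s)‖) atTop atTop
  tendsto_past : Tendsto (fun s => ‖f (γ s)‖) atBot atTop

/-- The integrand of `∫ e^{-zf} ν` along the curve `γ`. -/
def thimbleIntegrand (f : X → ℂ) (ν : (x : X) → TangentSpace 𝓘(ℂ) x →L[ℂ] ℂ) (γ : ℝ → X)
    (z : ℂ) (s : ℝ) : ℂ :=
  Complex.exp (-(z * f (γ s))) * ν (γ s) (velocity γ s)

/-- The thimble integral converges absolutely at the frequency `z`. -/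
def ThimbleIntegrable (f : X → ℂ) (ν : (x : X) → TangentSpace 𝓘(ℂ) x →L[ℂ] ℂ) (γ : ℝ → X)
    (z : ℂ) : Prop :=
  Integrable (thimbleIntegrand f ν γ z)

/-- The thimble integral `I_a(z) = ∫ e^{-zf} ν`. -/
def thimbleIntegral (f : X → ℂ) (ν : (x : X) → TangentSpace 𝓘(ℂ) x →L[ℂ] ℂ) (γ : ℝ → X)
    (z : ℂ) : ℂ :=
  ∫ s : ℝ, thimbleIntegrand f ν γ z s

end Manifold

end Thimble

end

/-! On the thimble `f = α + h e^{iθ}` with a real height `h ≥ 0` that vanishes only at `a` and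
increases to infinity along each half. Off the critical point `ν = (ν/df) df`, so taking the height
`t` as parameter on each half turns the thimble integral into `I_a(z) = e^{-αz} e^{iθ} ∫_0^∞ e^{-z
e^{iθ} t} J(t) dt`, where `J` is the difference of the values of `ν/df` on the two halves
(`exists_laplace_representation`). Everything follows from two properties of `J`.

Away from critical points `f` is a local coordinate, so `ν/df` is locally a holomorphic function of
`f`. Hence `J` is real-analytic on `(0, ∞)` and extends to a neighbourhood of the ray.

Near `a` there is a coordinate `W` with `W² = f - α`. There `ν/df` is a holomorphic function of `W`
divided by `W`, and the two halves are the two square roots of `f - α`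
(`exists_formRatio_branches`). So `J(t) = E(√t)/√t` with `E(v) = κ(v) + κ(-v)` even and holomorphic:
`J` is a convergent series in the powers `t^{n-1/2}`.

Watson's lemma (`exists_watson_remainder`) then gives the expansion, whose Borel transform is this
same series. Since an asymptotic expansion is unique (`HasAsymptoticExpansion.unique`), the
conclusions hold for every sequence of coefficients, and the Laplace integral of the continuation is
the integral of `J` again. -/

noncomputable section

namespace Thimble

open Complex Metric Set Topology

/-! ### Analytic continuation of a real-analytic function on the half-line -/

/-- `ψ` is a holomorphic extension of `J : ℝ → ℂ` to a convex open subset `S` of the right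
half-plane that is closed under projection to the real axis. -/
structure IsPatch (J : ℝ → ℂ) (S : Set ℂ) (ψ : ℂ → ℂ) : Prop where
  isOpen : IsOpen S
  convex : Convex ℝ S
  re_pos : ∀ ζ ∈ S, 0 < ζ.re
  re_mem : ∀ ζ ∈ S, (ζ.re : ℂ) ∈ S
  differentiableOn : DifferentiableOn ℂ ψ S
  eq_ofReal : ∀ t : ℝ, (t : ℂ) ∈ S → ψ t = J t

/-- The overlap is convex, hence connected, and contains a real point because both sets are closed
under real part. Near that point both extensions equal `J` on the real axis, so the identity theorem
applies. -/
theorem IsPatch.eqOn_inter {J : ℝ → ℂ} {S S' : Set ℂ} {ψ ψ' : ℂ → ℂ} (h : IsPatch J S ψ)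
    (h' : IsPatch J S' ψ') : EqOn ψ ψ' (S ∩ S') := by
  intro ζ hζ
  have ho : IsOpen (S ∩ S') := h.isOpen.inter h'.isOpen
  have hx : ((ζ.re : ℝ) : ℂ) ∈ S ∩ S' := ⟨h.re_mem ζ hζ.1, h'.re_mem ζ hζ.2⟩
  refine AnalyticOnNhd.eqOn_of_preconnected_of_frequently_eq
    ((h.differentiableOn.mono inter_subset_left).analyticOnNhd ho)
    ((h'.differentiableOn.mono inter_subset_right).analyticOnNhd ho)
    (h.convex.inter h'.convex).isPreconnected hx ?_ hζ
  have ht : Tendsto (fun t : ℝ => (t : ℂ)) (𝓝[≠] ζ.re) (𝓝[≠] (ζ.re : ℂ)) :=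
    continuous_ofReal.continuousAt.continuousWithinAt.tendsto_nhdsWithin
      fun t ht => by simpa using ht
  refine ht.frequently (Eventually.frequently ?_)
  filter_upwards [(ht.mono_right nhdsWithin_le_nhds).eventually (ho.mem_nhds hx)] with t ht
  rw [h.eq_ofReal t ht.1, h'.eq_ofReal t ht.2]

/-- The value at a point is read off from an arbitrarily chosen patch containing it;
`IsPatch.eqOn_inter` makes the choice irrelevant. One pair `(U, φ)` serves discs along the axis and
the half-disk at the tip simultaneously. -/
theorem exists_glue_patches (J : ℝ → ℂ) : ∃ (U : Set ℂ) (φ : ℂ → ℂ), IsOpen U ∧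
    DifferentiableOn ℂ φ U ∧ ∀ S ψ, IsPatch J S ψ → S ⊆ U ∧ EqOn φ ψ S := by
  classical
  let U : Set ℂ := {ζ | ∃ p : Set ℂ × (ℂ → ℂ), IsPatch J p.1 p.2 ∧ ζ ∈ p.1}
  let φ : ℂ → ℂ := fun ζ => if h : ζ ∈ U then h.choose.2 ζ else 0
  have key : ∀ S ψ, IsPatch J S ψ → S ⊆ U ∧ EqOn φ ψ S := by
    intro S ψ h
    have hS : S ⊆ U := fun ζ hζ => ⟨(S, ψ), h, hζ⟩
    refine ⟨hS, fun ζ hζ => ?_⟩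
    have hU := hS hζ
    simp only [φ, dif_pos hU]
    exact hU.choose_spec.1.eqOn_inter h ⟨hU.choose_spec.2, hζ⟩
  refine ⟨U, φ, isOpen_iff_mem_nhds.2 ?_, ?_, key⟩
  · rintro ζ ⟨p, hp, hζ⟩
    exact mem_of_superset (hp.isOpen.mem_nhds hζ) (key _ _ hp).1
  · rintro ζ ⟨p, hp, hζ⟩
    have hn := hp.isOpen.mem_nhds hζ
    exact (((hp.differentiableOn.differentiableAt hn).congr_of_eventuallyEq
      ((key _ _ hp).2.eventuallyEq_of_mem hn))).differentiableWithinAt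

theorem exists_patch_of_analyticAt {J : ℝ → ℂ} {t : ℝ} (ht : 0 < t) {ψ : ℂ → ℂ}
    (hψ : AnalyticAt ℂ ψ t) (hJ : ∀ᶠ t' in 𝓝 t, J t' = ψ t') :
    ∃ S, IsPatch J S ψ ∧ (t : ℂ) ∈ S := by
  obtain ⟨r₁, hr₁, h₁⟩ := Metric.eventually_nhds_iff_ball.1 hψ.eventually_analyticAt
  obtain ⟨r₂, hr₂, h₂⟩ := Metric.eventually_nhds_iff_ball.1 hJ
  -- The bound by `t` keeps the disc in the right half-plane.
  let r := min t (min r₁ r₂)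
  have hr : 0 < r := lt_min ht (lt_min hr₁ hr₂)
  have hre : ∀ ζ ∈ ball (t : ℂ) r, |ζ.re - t| < r := fun ζ hζ => by
    have := abs_re_le_norm (ζ - t)
    rw [mem_ball, dist_eq_norm] at hζ
    simp only [sub_re, ofReal_re] at this
    linarith
  refine ⟨ball t r, ⟨isOpen_ball, convex_ball _ _, fun ζ hζ => ?_, fun ζ hζ => ?_, ?_, ?_⟩,
    mem_ball_self hr⟩
  · have := (abs_lt.1 (hre ζ hζ)).1
    have := min_le_left t (min r₁ r₂)
    linarith
  · rw [mem_ball, dist_eq_norm, ← ofReal_sub, norm_real]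
    exact hre ζ hζ
  · exact fun ζ hζ => (h₁ ζ (ball_subset_ball ((min_le_right _ _).trans (min_le_left _ _))
      hζ)).differentiableAt.differentiableWithinAt
  · intro s hs
    refine (h₂ s ?_).symm
    have := hre s hs
    rw [mem_ball, Real.dist_eq]
    exact this.trans_le ((min_le_right _ _).trans (min_le_right _ _))

theorem isPatch_halfDisk {J : ℝ → ℂ} {E : ℂ → ℂ} {r : ℝ} (hr : 0 < r)
    (hE : DifferentiableOn ℂ E (ball 0 r))
    (hJ : ∀ t : ℝ, 0 < t → t < r ^ 2 → J t = E (√t : ℝ) / (√t : ℝ)) :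
    IsPatch J (ball 0 (r ^ 2) ∩ {ζ | 0 < ζ.re})
      fun ζ => E (ζ ^ (1 / 2 : ℂ)) / ζ ^ (1 / 2 : ℂ) := by
  have hsq : ∀ ζ ∈ ball (0 : ℂ) (r ^ 2), ζ ^ (1 / 2 : ℂ) ∈ ball (0 : ℂ) r := fun ζ hζ => by
    rw [mem_ball_zero_iff] at hζ ⊢
    have h2 : ‖ζ ^ (1 / 2 : ℂ)‖ ^ 2 = ‖ζ‖ := by
      rw [← norm_pow, ← cpow_nat_mul]; norm_num
    exact lt_of_pow_lt_pow_left₀ 2 hr.le (h2 ▸ hζ)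
  refine ⟨isOpen_ball.inter (isOpen_lt continuous_const continuous_re),
    (convex_ball _ _).inter (convex_halfSpace_re_gt 0), fun ζ h => h.2, fun ζ h => ⟨?_, by
      simpa using h.2⟩, ?_, fun t ht => ?_⟩
  · have := h.1
    rw [mem_ball_zero_iff] at this ⊢
    rw [norm_real]
    exact (abs_re_le_norm ζ).trans_lt this
  · rintro ζ ⟨h1, h2⟩
    have hs : ζ ∈ slitPlane := Or.inl h2
    have hd : DifferentiableAt ℂ (fun ζ : ℂ => ζ ^ (1 / 2 : ℂ)) ζ :=
      differentiableAt_id.cpow_const hs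
    have hE' : DifferentiableAt ℂ E (ζ ^ (1 / 2 : ℂ)) :=
      hE.differentiableAt (isOpen_ball.mem_nhds (hsq ζ h1))
    have hne : ζ ^ (1 / 2 : ℂ) ≠ 0 := by
      simpa using slitPlane_ne_zero hs
    exact ((hE'.comp ζ hd).div hd hne).differentiableWithinAt
  · have h0 : 0 < t := by simpa using ht.2
    have h1 : t < r ^ 2 := by
      have := ht.1
      rw [mem_ball_zero_iff, norm_real, Real.norm_of_nonneg h0.le] at this
      exact this
    have : (t : ℂ) ^ (1 / 2 : ℂ) = (√t : ℝ) := by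
      rw [Real.sqrt_eq_rpow, ofReal_cpow h0.le]; norm_num
    rw [hJ t h0 h1, ← this]

/-! ### Even power series -/

theorem exists_hasSum_even {E : ℂ → ℂ} {r : ℝ} (hE : DifferentiableOn ℂ E (ball 0 r))
    (heven : ∀ v, E (-v) = E v) :
    ∃ e : ℕ → ℂ, ∀ v ∈ ball (0 : ℂ) r, HasSum (fun n => e n * v ^ (2 * n)) (E v) := by
  let a : ℕ → ℂ := fun n => (n.factorial : ℂ)⁻¹ * iteratedDeriv n E 0
  have ha : ∀ v ∈ ball (0 : ℂ) r, HasSum (fun n => a n * v ^ n) (E v) := fun v hv => by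
    have h := hasSum_taylorSeries_on_ball hE hv
    have heq : (fun n => a n * v ^ n) =
        fun n => (n.factorial : ℂ)⁻¹ • (v - 0) ^ n • iteratedDeriv n E 0 := by
      funext n
      simp only [a, sub_zero, smul_eq_mul]; ring
    rwa [heq]
  refine ⟨fun n => a (2 * n), fun v hv => ?_⟩
  -- Averaging the Taylor series at `v` and `-v` cancels the odd terms.
  have hs := ((ha v hv).add (heven v ▸ ha (-v) (by simpa using hv))).div_const 2
  have hE2 : (E v + E v) / 2 = E v := by ring
  rw [hE2] at hs
  have hinj : Function.Injective fun n : ℕ => 2 * n := fun m n h => by simpa using h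
  convert! (hinj.hasSum_iff fun n hn => ?_).2 hs using 2 with n
  · simp only [Function.comp_apply, (even_two_mul n).neg_pow]; ring
  · have hodd : Odd n := Nat.not_even_iff_odd.1 fun h => hn (h.exists_two_nsmul.imp fun m hm => by
      simpa using hm.symm)
    rw [hodd.neg_pow]; ring

/-- With `v^{2(n+1)}` factored out, the tail is dominated by its sum of absolute values at radius
`r/2`. -/
theorem norm_sub_partialSum_even_le {E : ℂ → ℂ} {r : ℝ} (hr : 0 < r) {e : ℕ → ℂ}
    (he : ∀ v ∈ ball (0 : ℂ) r, HasSum (fun n => e n * v ^ (2 * n)) (E v)) (n : ℕ) :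
    ∃ C, 0 ≤ C ∧ ∀ v : ℂ, ‖v‖ ≤ r / 2 →
      ‖E v - ∑ k ∈ Finset.range (n + 1), e k * v ^ (2 * k)‖ ≤ C * ‖v‖ ^ (2 * (n + 1)) := by
  have hsum : Summable fun k => ‖e k‖ * (r / 2) ^ (2 * k) := by
    have := (he ((r / 2 : ℝ) : ℂ) (by
      rw [mem_ball_zero_iff, norm_real, Real.norm_of_nonneg (by positivity)]; linarith)).summable.norm
    refine this.congr fun k => ?_
    rw [norm_mul, norm_pow, norm_real, Real.norm_of_nonneg (by positivity)]
  have hsum' : Summable fun k => ‖e (k + (n + 1))‖ * (r / 2) ^ (2 * k) := by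
    have h := ((summable_nat_add_iff (n + 1)).2 hsum).mul_right (((r / 2) ^ (2 * (n + 1)))⁻¹)
    refine h.congr fun k => ?_
    have : (r / 2) ^ (2 * (n + 1)) ≠ 0 := by positivity
    field_simp
    ring
  refine ⟨∑' k, ‖e (k + (n + 1))‖ * (r / 2) ^ (2 * k), tsum_nonneg fun k => by positivity,
    fun v hv => ?_⟩
  have hv' : v ∈ ball (0 : ℂ) r := by rw [mem_ball_zero_iff]; linarith
  have h1 := (hasSum_nat_add_iff' (n + 1)).2 (he v hv')
  rw [← h1.tsum_eq]
  refine tsum_of_norm_bounded (hsum'.hasSum.mul_right _) fun k => ?_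
  rw [norm_mul, norm_pow, mul_add, pow_add, ← mul_assoc]
  gcongr

/-! ### Laplace integrals on the half-line -/

/-- The integral `∫_0^∞ e^{-yt} J(t) dt`. -/
def halfLineLaplace (J : ℝ → ℂ) (y : ℂ) : ℂ := ∫ t in Ioi (0 : ℝ), exp (-(y * t)) * J t

theorem norm_exp_neg_mul_ofReal (y : ℂ) (t : ℝ) : ‖exp (-(y * t))‖ = Real.exp (-(y.re * t)) := by
  rw [norm_exp]; simp

theorem aestronglyMeasurable_of_exp_mul {J : ℝ → ℂ} {μ : Measure ℝ} {y₀ : ℂ}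
    (h : AEStronglyMeasurable (fun t : ℝ => exp (-(y₀ * t)) * J t) μ) :
    AEStronglyMeasurable J μ := by
  have hc : Continuous fun t : ℝ => exp (y₀ * t) := by fun_prop
  refine (hc.aestronglyMeasurable.mul h).congr (Eventually.of_forall fun t => ?_)
  simp only [Pi.mul_apply]
  rw [← mul_assoc, ← exp_add, add_neg_cancel, exp_zero, one_mul]

theorem integrableOn_exp_mul_of_re_le {J : ℝ → ℂ} {y₀ y : ℂ}
    (h : IntegrableOn (fun t : ℝ => exp (-(y₀ * t)) * J t) (Ioi 0)) (hy : y₀.re ≤ y.re) :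
    IntegrableOn (fun t : ℝ => exp (-(y * t)) * J t) (Ioi 0) := by
  have hJ := aestronglyMeasurable_of_exp_mul h.aestronglyMeasurable
  have hc : Continuous fun t : ℝ => exp (-(y * t)) := by fun_prop
  refine Integrable.mono h (hc.aestronglyMeasurable.mul hJ) ?_
  filter_upwards [ae_restrict_mem measurableSet_Ioi] with t ht
  rw [norm_mul, norm_mul, norm_exp_neg_mul_ofReal, norm_exp_neg_mul_ofReal]
  have : 0 < t := ht
  gcongr

theorem differentiableAt_halfLineLaplace {J : ℝ → ℂ} {y₀ y : ℂ}
    (h : IntegrableOn (fun t : ℝ => exp (-(y₀ * t)) * J t) (Ioi 0)) (hy : y₀.re < y.re) :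
    DifferentiableAt ℂ (halfLineLaplace J) y := by
  have hJ := aestronglyMeasurable_of_exp_mul h.aestronglyMeasurable
  -- Half of the margin is given up so that `e^{εt}` absorbs the factor `t` produced by
  -- differentiation.
  set ε := (y.re - y₀.re) / 2 with hε
  have hε0 : 0 < ε := by linarith
  have hs : {w : ℂ | y₀.re + ε < w.re} ∈ 𝓝 y :=
    (isOpen_lt continuous_const continuous_re).mem_nhds (by change _ < y.re; linarith)
  have hc : ∀ w : ℂ, Continuous fun t : ℝ => exp (-(w * t)) := fun w => by fun_prop
  have hc' : Continuous fun t : ℝ => -(t : ℂ) * exp (-(y * t)) := by fun_prop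
  refine (hasDerivAt_integral_of_dominated_loc_of_deriv_le
    (F := fun (w : ℂ) (t : ℝ) => exp (-(w * t)) * J t)
    (F' := fun (w : ℂ) (t : ℝ) => (-(t : ℂ) * exp (-(w * t))) * J t)
    (bound := fun t : ℝ => ε⁻¹ * ‖exp (-(y₀ * t)) * J t‖) hs
    (Eventually.of_forall fun w => (hc w).aestronglyMeasurable.mul hJ)
    (integrableOn_exp_mul_of_re_le h hy.le) (hc'.aestronglyMeasurable.mul hJ) ?_
    (h.norm.const_mul _) ?_).2.differentiableAt
  · filter_upwards [ae_restrict_mem measurableSet_Ioi] with t ht w hw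
    have ht : 0 < t := ht
    have hw : y₀.re + ε < w.re := hw
    rw [norm_mul, norm_mul, norm_mul, norm_exp_neg_mul_ofReal, norm_exp_neg_mul_ofReal, norm_neg,
      norm_real, Real.norm_of_nonneg ht.le, ← mul_assoc]
    refine mul_le_mul_of_nonneg_right ?_ (norm_nonneg _)
    have h1 : ε * t ≤ Real.exp (ε * t) := by linarith [Real.add_one_le_exp (ε * t)]
    calc t * Real.exp (-(w.re * t)) = ε⁻¹ * ((ε * t) * Real.exp (-(w.re * t))) := by field_simp
      _ ≤ ε⁻¹ * (Real.exp (ε * t) * Real.exp (-((y₀.re + ε) * t))) := by gcongr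
      _ = ε⁻¹ * Real.exp (-(y₀.re * t)) := by rw [← Real.exp_add]; ring_nf
  · filter_upwards with t w _
    have h1 : HasDerivAt (fun w : ℂ => -(w * t)) (-(t : ℂ)) w :=
      (hasDerivAt_mul_const (t : ℂ)).fun_neg
    have := h1.cexp.mul_const (J t)
    convert! this using 1
    ring

theorem integrableOn_exp_mul_rpow {σ : ℝ} (hσ : 0 < σ) {y : ℂ} (hy : 0 < y.re) :
    IntegrableOn (fun t : ℝ => exp (-(y * t)) * (t ^ (σ - 1) : ℝ)) (Ioi 0) := by
  have h : IntegrableOn (fun t : ℝ => exp (-((y.re : ℂ) * t)) * (t ^ (σ - 1) : ℝ)) (Ioi 0) := by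
    have := (integrableOn_rpow_mul_exp_neg_mul_rpow (p := 1) (s := σ - 1) (by linarith) one_pos
      hy).ofReal (𝕜 := ℂ)
    refine IntegrableOn.congr_fun this (fun t ht => ?_) measurableSet_Ioi
    simp only [Real.rpow_one, coe_algebraMap]
    rw [ofReal_mul, ofReal_exp, mul_comm]
    push_cast
    ring_nf
  exact integrableOn_exp_mul_of_re_le h (by simp)

/-- For real `y > 0` this is Euler's integral; both sides are holomorphic in the right half-plane,
so the identity theorem gives the rest. -/
theorem halfLineLaplace_rpow {σ : ℝ} (hσ : 0 < σ) {y : ℂ} (hy : 0 < y.re) :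
    halfLineLaplace (fun t => ((t ^ (σ - 1) : ℝ) : ℂ)) y = Real.Gamma σ * y ^ (-(σ : ℂ)) := by
  have ho : IsOpen {y : ℂ | 0 < y.re} := isOpen_lt continuous_const continuous_re
  refine AnalyticOnNhd.eqOn_of_preconnected_of_frequently_eq (U := {y : ℂ | 0 < y.re})
    (z₀ := 1) (DifferentiableOn.analyticOnNhd (fun w hw => ?_) ho)
    (g := fun y : ℂ => Real.Gamma σ * y ^ (-(σ : ℂ)))
    (DifferentiableOn.analyticOnNhd (fun w hw => ?_) ho)
    (convex_halfSpace_re_gt 0).isPreconnected (by simp) ?_ hy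
  · have hw : 0 < w.re := hw
    refine (differentiableAt_halfLineLaplace (y₀ := (w.re / 2 : ℝ))
      (integrableOn_exp_mul_rpow hσ ?_) ?_).differentiableWithinAt
    · rw [ofReal_re]; positivity
    · rw [ofReal_re]; linarith
  · exact ((differentiableAt_id.cpow_const (Or.inl hw)).const_mul _).differentiableWithinAt
  · have ht : Tendsto (fun t : ℝ => (t : ℂ)) (𝓝[≠] 1) (𝓝[≠] ((1 : ℝ) : ℂ)) :=
      continuous_ofReal.continuousAt.continuousWithinAt.tendsto_nhdsWithin
        fun t ht => by simpa using ht
    rw [ofReal_one] at ht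
    refine ht.frequently (Eventually.frequently ?_)
    filter_upwards [nhdsWithin_le_nhds (Ioi_mem_nhds one_pos)] with r hr
    have hr : 0 < r := hr
    have hΓ := integral_cpow_mul_exp_neg_mul_Ioi (a := σ) (r := r) (by simpa using hσ) hr
    rw [one_div, inv_cpow _ _ (by rw [arg_ofReal_of_nonneg hr.le]; exact Real.pi_pos.ne),
      ← cpow_neg, mul_comm, Gamma_ofReal] at hΓ
    rw [← hΓ]
    refine setIntegral_congr_fun measurableSet_Ioi fun t ht => ?_
    simp only
    rw [ofReal_cpow (le_of_lt ht), mul_comm]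
    push_cast
    rfl

/-- The remainder estimate in Watson's lemma. -/
theorem norm_halfLineLaplace_le {g : ℝ → ℂ} {x₀ r C σ : ℝ} (hσ : 0 < σ) (hC : 0 ≤ C)
    (hint : IntegrableOn (fun t : ℝ => exp (-((x₀ : ℂ) * t)) * g t) (Ioi 0))
    (hg : ∀ t, 0 < t → t < r → ‖g t‖ ≤ C * t ^ (σ - 1)) {y : ℂ} (hy : 0 < y.re)
    (hxy : x₀ ≤ y.re) :
    ‖halfLineLaplace g y‖ ≤ C * ((1 / y.re) ^ σ * Real.Gamma σ) +
      Real.exp (-((y.re - x₀) * r)) * ∫ t in Ioi (0 : ℝ), ‖exp (-((x₀ : ℂ) * t)) * g t‖ := by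
  have h1 : IntegrableOn (fun t : ℝ => C * (t ^ (σ - 1) * Real.exp (-(y.re * t)))) (Ioi 0) := by
    have := (integrableOn_rpow_mul_exp_neg_mul_rpow (p := 1) (s := σ - 1) (by linarith) one_pos
      hy).const_mul C
    simp only [Real.rpow_one, neg_mul] at this
    exact this
  have h2 := hint.norm.const_mul (Real.exp (-((y.re - x₀) * r)))
  rw [← Real.integral_rpow_mul_exp_neg_mul_Ioi hσ hy, ← integral_const_mul, ← integral_const_mul,
    ← integral_add h1 h2]
  refine norm_integral_le_of_norm_le (h1.add h2) ?_
  filter_upwards [ae_restrict_mem measurableSet_Ioi] with t ht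
  have ht : 0 < t := ht
  simp only [norm_mul, norm_exp_neg_mul_ofReal, ofReal_re]
  -- The two terms of the bound are nonnegative on the whole half-line: below `r` the first one
  -- suffices, above `r` the second.
  rcases lt_or_ge t r with htr | htr
  · have h3 := hg t ht htr
    have h4 : 0 ≤ Real.exp (-((y.re - x₀) * r)) * (Real.exp (-(x₀ * t)) * ‖g t‖) := by positivity
    calc Real.exp (-(y.re * t)) * ‖g t‖ ≤ Real.exp (-(y.re * t)) * (C * t ^ (σ - 1)) := by gcongr
      _ = C * (t ^ (σ - 1) * Real.exp (-(y.re * t))) := by ring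
      _ ≤ _ := by linarith
  · have h3 : 0 ≤ C * (t ^ (σ - 1) * Real.exp (-(y.re * t))) := by positivity
    have h4 : Real.exp (-(y.re * t)) ≤ Real.exp (-((y.re - x₀) * r)) * Real.exp (-(x₀ * t)) := by
      rw [← Real.exp_add]
      refine Real.exp_le_exp.2 ?_
      nlinarith [mul_nonneg (sub_nonneg.2 hxy) (sub_nonneg.2 htr)]
    calc Real.exp (-(y.re * t)) * ‖g t‖
        ≤ Real.exp (-((y.re - x₀) * r)) * Real.exp (-(x₀ * t)) * ‖g t‖ := by gcongr
      _ ≤ _ := by linarith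

theorem halfLineLaplace_isBigO {g : ℝ → ℂ} {x₀ r C σ : ℝ} (hσ : 0 < σ) (hr : 0 < r) (hC : 0 ≤ C)
    (hint : IntegrableOn (fun t : ℝ => exp (-((x₀ : ℂ) * t)) * g t) (Ioi 0))
    (hg : ∀ t, 0 < t → t < r → ‖g t‖ ≤ C * t ^ (σ - 1)) {ω : ℂ} (hω : 0 < ω.re) :
    (fun ρ : ℝ => halfLineLaplace g (ρ * ω)) =O[atTop] fun ρ : ℝ => ρ ^ (-σ) := by
  set M := ∫ t in Ioi (0 : ℝ), ‖exp (-((x₀ : ℂ) * t)) * g t‖ with hM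
  have hexp : (fun ρ : ℝ => Real.exp (x₀ * r) * M * Real.exp (-(ω.re * r) * ρ)) =O[atTop]
      fun ρ : ℝ => ρ ^ (-σ) :=
    (isLittleO_exp_neg_mul_rpow_atTop (mul_pos hω hr) (-σ)).isBigO.const_mul_left _
  have hpow : (fun ρ : ℝ => C * ((1 / ω.re) ^ σ * Real.Gamma σ) * ρ ^ (-σ)) =O[atTop]
      fun ρ : ℝ => ρ ^ (-σ) := Asymptotics.isBigO_const_mul_self _ _ _
  refine (Asymptotics.IsBigO.of_bound 1 ?_).trans (hpow.add hexp)
  have hlim : Tendsto (fun ρ : ℝ => ρ * ω.re) atTop atTop := tendsto_id.atTop_mul_const hω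
  filter_upwards [eventually_gt_atTop 0, hlim.eventually_ge_atTop x₀] with ρ hρ hρx
  have hre : ((ρ : ℂ) * ω).re = ρ * ω.re := by simp
  have := norm_halfLineLaplace_le hσ hC hint hg (y := ρ * ω) (by rw [hre]; positivity)
    (by rw [hre]; exact hρx)
  rw [one_mul]
  rw [← hM] at this
  refine (this.trans_eq ?_).trans (le_abs_self _)
  rw [hre, one_div, mul_inv, Real.mul_rpow (by positivity) (by positivity),
    Real.inv_rpow hρ.le, ← Real.rpow_neg hρ.le, mul_assoc (Real.exp (x₀ * r)), mul_comm M,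
    ← mul_assoc (Real.exp (x₀ * r)), ← Real.exp_add]
  ring_nf

/-! ### Powers in a given direction; uniqueness of asymptotic expansions -/

theorem norm_dirPow (β : ℝ) {u : ℂ} (hu : u ≠ 0) (σ : ℝ) : ‖dirPow β u σ‖ = ‖u‖ ^ σ := by
  have h1 : ∀ x : ℝ, ‖exp (x * I)‖ = 1 := norm_exp_ofReal_mul_I
  have h2 : ‖exp (-(β * I)) * u‖ = ‖u‖ := by
    have := h1 (-β)
    rw [ofReal_neg, neg_mul] at this
    rw [norm_mul, this, one_mul]
  have h3 := h1 (β * σ)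
  rw [ofReal_mul] at h3
  rw [dirPow, norm_mul, h3, one_mul, norm_cpow_of_ne_zero (mul_ne_zero (exp_ne_zero _) hu), h2]
  simp

theorem dirPow_ne_zero (β : ℝ) {u : ℂ} (hu : u ≠ 0) (σ : ℝ) : dirPow β u σ ≠ 0 := by
  rw [← norm_ne_zero_iff, norm_dirPow β hu]
  exact (Real.rpow_pos_of_pos (norm_pos_iff.2 hu) _).ne'

/-- On the central ray, once the lower coefficients agree, the difference of the two expansions at
order `n` is `c n - c' n` times a nowhere vanishing function, and it is little-o of that function.
-/
theorem HasAsymptoticExpansion.unique {D : Set ℂ} {Φ : ℂ → ℂ} {β : ℝ} {α : ℂ} {τ : ℝ}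
    {c c' : ℕ → ℂ} (h : HasAsymptoticExpansion D Φ β α τ c)
    (h' : HasAsymptoticExpansion D Φ β α τ c') : c = c' := by
  obtain ⟨δ, R, hδ, -, -, -, -, h⟩ := h
  obtain ⟨δ', R', hδ', -, -, -, -, h'⟩ := h'
  funext n
  induction n using Nat.strong_induction_on with
  | _ n ih =>
  have h1 := h 0 (by simpa using hδ) n
  have h2 := h' 0 (by simpa using hδ') n
  have h3 := h2.sub h1
  set z : ℝ → ℂ := fun ρ => ρ * exp ((β + 0 : ℝ) * I)
  set X : ℝ → ℂ := fun ρ => exp (-(α * z ρ)) * dirPow β (z ρ) (-τ - n) with hX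
  have h4 : (fun ρ => (c n - c' n) * X ρ) =o[atTop] X := by
    refine h3.congr_left fun ρ => ?_
    rw [Finset.sum_range_succ, Finset.sum_range_succ,
      Finset.sum_congr rfl fun k hk => by rw [← ih k (Finset.mem_range.1 hk)]]
    simp only [hX]
    ring
  by_contra hne
  refine Asymptotics.isLittleO_irrefl (Eventually.frequently ?_)
    ((Asymptotics.isLittleO_const_mul_left_iff (sub_ne_zero.2 hne)).1 h4)
  filter_upwards [eventually_gt_atTop 0] with ρ hρ
  exact mul_ne_zero (exp_ne_zero _) (dirPow_ne_zero _
    (mul_ne_zero (ofReal_ne_zero.2 hρ.ne') (exp_ne_zero _)) _)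

/-! ### Borel regularity of Laplace integrals of half-integer series -/

/-- The coefficients of the asymptotic expansion of the Laplace integral, along the ray of
direction `θ`, of a function of `ζ = α + t e^{iθ}` that equals `∑ e n t^{n - 1/2}` for small
`t > 0`. -/
def expansionCoeff (θ : ℝ) (e : ℕ → ℂ) (n : ℕ) : ℂ :=
  e n * Real.Gamma (1 / 2 + n) * exp (θ * (1 / 2 - n) * I)

theorem borelCoeff_expansionCoeff (θ : ℝ) (e : ℕ → ℂ) (n : ℕ) :
    borelCoeff (1 / 2) (expansionCoeff θ e) n = e n * exp (θ * (1 / 2 - n) * I) := by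
  have : (Real.Gamma (1 / 2 + n) : ℂ) ≠ 0 :=
    ofReal_ne_zero.2 (Real.Gamma_pos_of_pos (by positivity)).ne'
  rw [borelCoeff, expansionCoeff, div_eq_iff this]
  ring

/-- Watson's lemma. The terms `e k * t^{k-1/2}` integrate exactly to Gamma factors. What remains of
`J` is `O(t^{n+1/2})` at `0`, so its integral is `O(ρ^{-n-3/2})`, one order better than needed.
Positivity of `x₀` makes the subtracted powers integrable at the same abscissa as `J`. -/
theorem exists_watson_remainder {J : ℝ → ℂ} {E : ℂ → ℂ} {r x₀ : ℝ} (hr : 0 < r) {e : ℕ → ℂ}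
    (he : ∀ v ∈ ball (0 : ℂ) r, HasSum (fun n => e n * v ^ (2 * n)) (E v))
    (hJ : ∀ t : ℝ, 0 < t → t < r ^ 2 → J t = E (√t : ℝ) / (√t : ℝ)) (hx₀ : 0 < x₀)
    (hint : IntegrableOn (fun t : ℝ => exp (-((x₀ : ℂ) * t)) * J t) (Ioi 0)) (n : ℕ)
    {ω : ℂ} (hω : 0 < ω.re) :
    (fun ρ : ℝ => halfLineLaplace J (ρ * ω) - ∑ k ∈ Finset.range (n + 1),
      e k * Real.Gamma (1 / 2 + k) * (ρ * ω) ^ ((-(1 / 2) - k : ℝ) : ℂ))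
      =o[atTop] fun ρ : ℝ => ρ ^ (-(1 / 2) - n : ℝ) := by
  let p : ℕ → ℝ → ℂ := fun k t => ((t ^ ((1 / 2 + k : ℝ) - 1) : ℝ) : ℂ)
  let g : ℝ → ℂ := fun t => J t - ∑ k ∈ Finset.range (n + 1), e k * p k t
  obtain ⟨C, hC, hCb⟩ := norm_sub_partialSum_even_le hr he n
  have hpos : ∀ k : ℕ, (0 : ℝ) < 1 / 2 + k := fun k => by positivity
  have hp : ∀ (k : ℕ) {y : ℂ}, 0 < y.re →
      IntegrableOn (fun t : ℝ => exp (-(y * t)) * (e k * p k t)) (Ioi 0) := fun k y hy => by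
    refine ((integrableOn_exp_mul_rpow (hpos k) hy).const_mul (e k)).congr
      (Eventually.of_forall fun t => ?_)
    simp only [p]; ring
  have hgy : ∀ {y : ℂ} (t : ℝ), exp (-(y * t)) * g t = exp (-(y * t)) * J t -
      ∑ k ∈ Finset.range (n + 1), exp (-(y * t)) * (e k * p k t) := fun t => by
    simp only [g, mul_sub, Finset.mul_sum]
  have hgint : IntegrableOn (fun t : ℝ => exp (-((x₀ : ℂ) * t)) * g t) (Ioi 0) := by
    simp only [hgy]
    exact hint.sub (integrable_finsetSum _ fun k _ => hp k (by simpa using hx₀))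
  have hgb : ∀ t, 0 < t → t < (r / 2) ^ 2 → ‖g t‖ ≤ C * t ^ ((n + 3 / 2 : ℝ) - 1) := by
    intro t ht htr
    have hv : 0 < √t := Real.sqrt_pos.2 ht
    have hvr : √t ≤ r / 2 := (Real.sqrt_le_left (by positivity)).2 htr.le
    have htr' : t < r ^ 2 := htr.trans (by gcongr; linarith)
    have hpk : ∀ k : ℕ, p k t = ((√t : ℝ) : ℂ) ^ (2 * k) / (√t : ℝ) := fun k => by
      simp only [p]
      rw [← ofReal_pow, ← ofReal_div, pow_mul, Real.sq_sqrt ht.le]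
      congr 1
      rw [eq_div_iff hv.ne', Real.sqrt_eq_rpow, ← Real.rpow_natCast, ← Real.rpow_add ht]
      ring_nf
    have hg : g t = (E (√t : ℝ) - ∑ k ∈ Finset.range (n + 1), e k * ((√t : ℝ) : ℂ) ^ (2 * k)) /
        (√t : ℝ) := by
      simp only [g, hpk, hJ t ht htr', sub_div, Finset.sum_div, mul_div_assoc]
    have hb := hCb (√t : ℝ) (by rwa [norm_real, Real.norm_of_nonneg hv.le])
    rw [norm_real, Real.norm_of_nonneg hv.le] at hb
    rw [hg, norm_div, norm_real, Real.norm_of_nonneg hv.le, div_le_iff₀ hv]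
    refine hb.trans_eq ?_
    rw [pow_mul, Real.sq_sqrt ht.le, mul_assoc, Real.sqrt_eq_rpow, ← Real.rpow_natCast,
      ← Real.rpow_add ht]
    push_cast
    ring_nf
  have hO := halfLineLaplace_isBigO (σ := n + 3 / 2) (by positivity) (by positivity) hC hgint hgb hω
  have ho : (fun ρ : ℝ => ρ ^ (-(n + 3 / 2) : ℝ)) =o[atTop] fun ρ : ℝ => ρ ^ (-(1 / 2) - n : ℝ) := by
    have h := tendsto_inv_atTop_zero (𝕜 := ℝ)
    refine (Asymptotics.isLittleO_iff_tendsto' ?_).2 (h.congr' ?_)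
    · filter_upwards [eventually_gt_atTop 0] with ρ hρ h0
      exact absurd h0 (Real.rpow_pos_of_pos hρ _).ne'
    · filter_upwards [eventually_gt_atTop 0] with ρ hρ
      rw [← Real.rpow_sub hρ, ← Real.rpow_neg_one]
      ring_nf
  refine (hO.trans_isLittleO ho).congr' ?_ EventuallyEq.rfl
  have hlim : Tendsto (fun ρ : ℝ => ρ * ω.re) atTop atTop := tendsto_id.atTop_mul_const hω
  filter_upwards [hlim.eventually_ge_atTop x₀] with ρ hρx
  have hre : ((ρ : ℂ) * ω).re = ρ * ω.re := by simp
  have hy : 0 < ((ρ : ℂ) * ω).re := by rw [hre]; linarith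
  have hJy := integrableOn_exp_mul_of_re_le hint (y := ρ * ω) (by rw [hre]; simpa using hρx)
  rw [halfLineLaplace]
  simp only [hgy]
  rw [integral_sub hJy (integrable_finsetSum _ fun k _ => hp k hy),
    integral_finsetSum _ fun k _ => hp k hy]
  congr 1
  refine Finset.sum_congr rfl fun k _ => ?_
  have := halfLineLaplace_rpow (hpos k) hy
  rw [halfLineLaplace] at this
  have h2 : ((-(1 / 2) - k : ℝ) : ℂ) = -((1 / 2 + k : ℝ) : ℂ) := by push_cast; ring
  rw [h2, mul_assoc, ← this, ← integral_const_mul]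
  refine setIntegral_congr_fun measurableSet_Ioi fun t _ => ?_
  simp only [p]; ring

theorem hasAsymptoticExpansion_of_laplace {D : Set ℂ} {Φ : ℂ → ℂ} {θ : ℝ} {α : ℂ} {J : ℝ → ℂ}
    {E : ℂ → ℂ} {r : ℝ} (hr : 0 < r) {e : ℕ → ℂ}
    (he : ∀ v ∈ ball (0 : ℂ) r, HasSum (fun n => e n * v ^ (2 * n)) (E v))
    (hJ : ∀ t : ℝ, 0 < t → t < r ^ 2 → J t = E (√t : ℝ) / (√t : ℝ)) (hD : D.Nonempty)
    (hup : ∀ z ∈ D, ∀ z', (z * exp (θ * I)).re ≤ (z' * exp (θ * I)).re → z' ∈ D)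
    (hint : ∀ z ∈ D, IntegrableOn (fun t : ℝ => exp (-(z * exp (θ * I) * t)) * J t) (Ioi 0))
    (hΦ : ∀ z ∈ D, Φ z = exp (-(α * z)) * exp (θ * I) * halfLineLaplace J (z * exp (θ * I))) :
    HasAsymptoticExpansion D Φ (-θ) α (1 / 2) (expansionCoeff θ e) := by
  obtain ⟨z₀, hz₀⟩ := hD
  set u : ℂ := exp (θ * I) with hu
  set x₀ : ℝ := |(z₀ * u).re| + 1 with hx₀
  have hx₀pos : 0 < x₀ := by positivity
  have hz₀x : (z₀ * u).re < x₀ := (le_abs_self _).trans_lt (lt_add_one _)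
  have hHD : ∀ z : ℂ, x₀ < (z * u).re → z ∈ D := fun z hz => hup z₀ hz₀ z (hz₀x.trans hz).le
  have hmul : ∀ ρ ψ : ℝ, (ρ * exp ((-θ + ψ : ℝ) * I) : ℂ) * u = ρ * exp (ψ * I) := fun ρ ψ => by
    rw [hu, mul_assoc, ← exp_add]; push_cast; ring_nf
  -- With half-opening `π/3` the cosine exceeds `1/2`, so `|z| > 2 x₀` forces `Re(z e^{iθ}) > x₀` on
  -- the sector.
  have hcos : ∀ ψ : ℝ, |ψ| < Real.pi / 3 → 1 / 2 < Real.cos ψ := fun ψ hψ => by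
    rw [← Real.cos_abs ψ, ← Real.cos_pi_div_three]
    exact Real.cos_lt_cos_of_nonneg_of_le_pi (abs_nonneg _) (by linarith [Real.pi_pos]) hψ
  have hsec : ∀ z ∈ sectorAtInfty (-θ) (Real.pi / 3) (2 * x₀), x₀ < (z * u).re := by
    rintro z ⟨ρ, ψ, hρ, hψ, rfl⟩
    rw [hmul, re_ofReal_mul, exp_ofReal_mul_I_re]
    nlinarith [hcos ψ hψ]
  have hx₀int : IntegrableOn (fun t : ℝ => exp (-((x₀ : ℂ) * t)) * J t) (Ioi 0) :=
    integrableOn_exp_mul_of_re_le (hint z₀ hz₀) (by simpa using hz₀x.le)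
  refine ⟨Real.pi / 3, 2 * x₀, by positivity, by linarith [Real.pi_pos], by positivity,
    fun z hz => hHD z (hsec z hz), fun z hz => ?_, fun ψ hψ n => ?_⟩
  · have ho : {z : ℂ | x₀ < (z * u).re} ∈ 𝓝 z :=
      (isOpen_lt continuous_const (by fun_prop)).mem_nhds (hsec z hz)
    have hL : DifferentiableAt ℂ (fun z => halfLineLaplace J (z * u)) z :=
      (differentiableAt_halfLineLaplace hx₀int (by simpa using hsec z hz)).comp z
        (by fun_prop : DifferentiableAt ℂ (fun z => z * u) z)
    have hd : DifferentiableAt ℂ (fun z => exp (-(α * z)) * u * halfLineLaplace J (z * u)) z :=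
      DifferentiableAt.mul (by fun_prop) hL
    refine (hd.congr_of_eventuallyEq ?_).differentiableWithinAt
    filter_upwards [ho] with w hw using hΦ w (hHD w hw)
  · intro z
    have hω : 0 < (exp (ψ * I)).re := by
      rw [exp_ofReal_mul_I_re]; linarith [hcos ψ hψ]
    have hW := exists_watson_remainder hr he hJ hx₀pos hx₀int n hω
    have hz0 : ∀ ρ : ℝ, 0 < ρ → z ρ ≠ 0 := fun ρ hρ =>
      mul_ne_zero (ofReal_ne_zero.2 hρ.ne') (exp_ne_zero _)
    have hdir : (fun ρ : ℝ => ρ ^ (-(1 / 2) - n : ℝ)) =O[atTop]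
        fun ρ => dirPow (-θ) (z ρ) (-(1 / 2) - n) := by
      refine Asymptotics.IsBigO.of_bound 1 ?_
      filter_upwards [eventually_gt_atTop 0] with ρ hρ
      rw [one_mul, norm_dirPow _ (hz0 ρ hρ), Real.norm_of_nonneg (by positivity)]
      simp only [z]
      rw [norm_mul, norm_exp_ofReal_mul_I, mul_one, norm_real, Real.norm_of_nonneg hρ.le]
    have hmain := (Asymptotics.isBigO_refl (fun ρ => exp (-(α * z ρ))) atTop).mul_isLittleO
      ((hW.trans_isBigO hdir).const_mul_left u)
    refine hmain.congr' ?_ EventuallyEq.rfl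
    filter_upwards [eventually_gt_atTop (2 * x₀)] with ρ hρ
    have hzD : z ρ ∈ D := hHD _ (hsec _ ⟨ρ, ψ, hρ, hψ, rfl⟩)
    rw [hΦ _ hzD, hmul, mul_sub, mul_sub, mul_assoc]
    congr 2
    rw [Finset.mul_sum]
    refine Finset.sum_congr rfl fun k _ => ?_
    have h1 : exp (-(((-θ : ℝ) : ℂ) * I)) * z ρ = ρ * exp (ψ * I) := by
      rw [← hmul, mul_comm, hu, ofReal_neg, neg_mul, neg_neg]
    rw [dirPow, h1, expansionCoeff]
    -- The factor `e^{iθ}` coming from `dζ` is the phase in `expansionCoeff` times the phase in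
    -- `dirPow`.
    have h2 : u = exp (θ * (1 / 2 - k) * I) *
        exp (((-θ : ℝ) : ℂ) * ((-(1 / 2) - k : ℝ) : ℂ) * I) := by
      rw [hu, ← exp_add]; push_cast; ring_nf
    conv_lhs => rw [h2]
    ring

theorem convergesNearTip_expansionCoeff (θ : ℝ) {E : ℂ → ℂ} {r : ℝ} (hr : 0 < r) {e : ℕ → ℂ}
    (he : ∀ v ∈ ball (0 : ℂ) r, HasSum (fun n => e n * v ^ (2 * n)) (E v)) :
    ConvergesNearTip (borelCoeff (1 / 2) (expansionCoeff θ e)) := by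
  refine ⟨(r / 2) ^ 2, by positivity, ?_⟩
  have := (he ((r / 2 : ℝ) : ℂ) (by
    rw [mem_ball_zero_iff, norm_real, Real.norm_of_nonneg (by positivity)]; linarith)).summable.norm
  refine this.congr fun k => ?_
  have h1 : ‖exp (θ * (1 / 2 - k) * I)‖ = 1 := by
    have := norm_exp_ofReal_mul_I (θ * (1 / 2 - k))
    push_cast at this
    exact this
  rw [borelCoeff_expansionCoeff, norm_mul, norm_mul, h1, mul_one, norm_pow, norm_real,
    Real.norm_of_nonneg (by positivity), pow_mul]

/-- The rotation `w` carries the ray to the positive axis. There the local extensions of `J` and the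
half-disk extension `E(√w)/√w` are patches, and the glued function is pulled back. -/
theorem exists_isContinuationAlongRay (θ : ℝ) (α : ℂ) {J : ℝ → ℂ} {E : ℂ → ℂ} {r : ℝ} (hr : 0 < r)
    (hE : DifferentiableOn ℂ E (ball 0 r)) {e : ℕ → ℂ}
    (he : ∀ v ∈ ball (0 : ℂ) r, HasSum (fun n => e n * v ^ (2 * n)) (E v))
    (hJ₀ : ∀ t : ℝ, 0 < t → t < r ^ 2 → J t = E (√t : ℝ) / (√t : ℝ))
    (hJ : ∀ t : ℝ, 0 < t → ∃ ψ : ℂ → ℂ, AnalyticAt ℂ ψ t ∧ ∀ᶠ t' : ℝ in 𝓝 t, J t' = ψ t') :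
    ∃ (U : Set ℂ) (φ : ℂ → ℂ), IsContinuationAlongRay α θ (1 / 2)
      (borelCoeff (1 / 2) (expansionCoeff θ e)) U φ ∧
      ∀ t : ℝ, 0 < t → φ (α + t * exp (θ * I)) = J t := by
  obtain ⟨V, χ, hV, hχ, hpatch⟩ := exists_glue_patches J
  let w : ℂ → ℂ := fun ζ => exp (-(θ * I)) * (ζ - α)
  have hw : Differentiable ℂ w := by fun_prop
  have hwt : ∀ t : ℝ, w (α + t * exp (θ * I)) = t := fun t => by
    have : exp (-(θ * I)) * exp (θ * I) = 1 := by rw [← exp_add]; simp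
    simp only [w]
    linear_combination (t : ℂ) * this
  have hwn : ∀ ζ, ‖w ζ‖ = ‖ζ - α‖ := fun ζ => by
    have := norm_exp_ofReal_mul_I (-θ)
    rw [ofReal_neg, neg_mul] at this
    simp only [w, norm_mul, this, one_mul]
  have hreal : ∀ t : ℝ, 0 < t → (t : ℂ) ∈ V ∧ χ t = J t := fun t ht => by
    obtain ⟨ψ, hψ, hψJ⟩ := hJ t ht
    obtain ⟨S, hS, htS⟩ := exists_patch_of_analyticAt ht hψ hψJ
    have := hpatch S ψ hS
    exact ⟨this.1 htS, (this.2 htS).trans (hS.eq_ofReal t htS)⟩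
  have hdisk := hpatch _ _ (isPatch_halfDisk hr hE hJ₀)
  refine ⟨w ⁻¹' V, χ ∘ w, ⟨hV.preimage hw.continuous, ?_, ?_, r ^ 2, by positivity,
    fun ζ hζ hre => ?_⟩, fun t ht => ?_⟩
  · rintro ζ ⟨t, ht, rfl⟩
    rw [mem_preimage, hwt]
    exact (hreal t ht).1
  · exact hχ.comp hw.differentiableOn fun ζ hζ => hζ
  · have hmem : w ζ ∈ ball (0 : ℂ) (r ^ 2) ∩ {ζ | 0 < ζ.re} :=
      ⟨by rw [mem_ball_zero_iff, hwn]; exact hζ, hre⟩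
    refine ⟨hdisk.1 hmem, ?_⟩
    have hw0 : w ζ ≠ 0 := fun h => by
      have h2 := hmem.2
      rw [h] at h2
      exact lt_irrefl (0 : ℝ) h2
    set v := w ζ ^ (1 / 2 : ℂ) with hv
    have hv2 : v ^ 2 = w ζ := by
      rw [hv, ← cpow_nat_mul]; norm_num
    have hvr : v ∈ ball (0 : ℂ) r := by
      rw [mem_ball_zero_iff]
      refine lt_of_pow_lt_pow_left₀ 2 hr.le ?_
      rw [← norm_pow, hv2, hwn]
      exact hζ
    rw [Function.comp_apply, hdisk.2 hmem]
    have hs := (he v hvr).div_const v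
    have heq : (fun n : ℕ => borelCoeff (1 / 2) (expansionCoeff θ e) n *
        dirPow θ (ζ - α) (1 / 2 - 1 + n)) = fun n => e n * v ^ (2 * n) / v := by
      funext n
      have h1 : exp (θ * (1 / 2 - n) * I) * exp (θ * ((1 / 2 - 1 + n : ℝ) : ℂ) * I) = 1 := by
        rw [← exp_add, exp_eq_one_iff]
        exact ⟨0, by push_cast; ring⟩
      have h2 : w ζ ^ ((1 / 2 - 1 + n : ℝ) : ℂ) = v ^ (2 * n) / v := by
        rw [pow_mul, hv2, hv, ← cpow_natCast, ← cpow_sub _ _ hw0]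
        congr 1
        push_cast
        ring
      rw [borelCoeff_expansionCoeff, dirPow]
      change _ * (_ * w ζ ^ _) = _
      rw [h2]
      linear_combination (e n * (v ^ (2 * n) / v)) * h1
    rw [heq]
    exact hs
  · rw [Function.comp_apply, hwt, (hreal t ht).2]

theorem isBorelRegular_of_laplace {D : Set ℂ} {Φ : ℂ → ℂ} {θ : ℝ} {α : ℂ} {J : ℝ → ℂ}
    {E : ℂ → ℂ} {r : ℝ} (hr : 0 < r) (hE : DifferentiableOn ℂ E (ball 0 r))
    (heven : ∀ v, E (-v) = E v)
    (hJ₀ : ∀ t : ℝ, 0 < t → t < r ^ 2 → J t = E (√t : ℝ) / (√t : ℝ))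
    (hJ : ∀ t : ℝ, 0 < t → ∃ ψ : ℂ → ℂ, AnalyticAt ℂ ψ t ∧ ∀ᶠ t' : ℝ in 𝓝 t, J t' = ψ t')
    (hD : D.Nonempty)
    (hup : ∀ z ∈ D, ∀ z', (z * exp (θ * I)).re ≤ (z' * exp (θ * I)).re → z' ∈ D)
    (hint : ∀ z ∈ D, IntegrableOn (fun t : ℝ => exp (-(z * exp (θ * I) * t)) * J t) (Ioi 0))
    (hΦ : ∀ z ∈ D, Φ z = exp (-(α * z)) * exp (θ * I) * halfLineLaplace J (z * exp (θ * I))) :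
    IsBorelRegular D Φ θ α (1 / 2) := by
  obtain ⟨e, he⟩ := exists_hasSum_even hE heven
  have hexp := hasAsymptoticExpansion_of_laplace hr he hJ₀ hD hup hint hΦ
  refine ⟨⟨_, hexp⟩, fun c hc => ?_, fun c hc => ?_⟩
  · rw [hc.unique hexp]
    exact convergesNearTip_expansionCoeff θ hr he
  · rw [hc.unique hexp]
    obtain ⟨U, φ, hφ, hφJ⟩ := exists_isContinuationAlongRay θ α hr hE he hJ₀ hJ
    refine ⟨U, φ, hφ, fun z hz => ?_⟩
    have heq : EqOn (fun t : ℝ => exp (-(α * z)) * exp (θ * I) *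
        (exp (-(z * exp (θ * I) * t)) * J t)) (laplaceIntegrand α θ φ z) (Ioi 0) := by
      intro t ht
      have h1 : exp (-(z * (α + t * exp (θ * I)))) =
          exp (-(α * z)) * exp (-(z * exp (θ * I) * t)) := by
        rw [← exp_add]; ring_nf
      simp only [laplaceIntegrand]
      rw [hφJ t ht, h1]
      ring
    refine ⟨IntegrableOn.congr_fun ((hint z hz).const_mul _) heq measurableSet_Ioi, ?_⟩
    rw [laplace, hΦ z hz, halfLineLaplace, ← integral_const_mul]
    exact (setIntegral_congr_fun measurableSet_Ioi heq).symm

/-! ### Reparametrization of a half of the thimble by the height -/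

/-- By Darboux the nonvanishing derivative has constant sign on `(0, ∞)`; a negative sign
contradicts `h ≥ 0 = h 0`. So `h` is an increasing bijection of `(0, ∞)`, and `G` is `q` expressed
through the height. -/
theorem exists_reparametrization {h h' : ℝ → ℝ} {q P : ℝ → ℂ} {r : ℝ}
    (hd : ∀ s, HasStrictDerivAt h (h' s) s) (h0 : h 0 = 0) (hnn : ∀ s, 0 ≤ h s)
    (hne : ∀ s, 0 < s → h' s ≠ 0) (hlim : Tendsto h atTop atTop)
    (hloc : ∀ s, 0 < s → ∃ ψ : ℂ → ℂ, AnalyticAt ℂ ψ (h s) ∧ ∀ᶠ s' in 𝓝 s, q s' = ψ (h s'))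
    (hr : 0 < r) (hP : ∀ s, 0 < s → s < r → q s = P (h s)) :
    ∃ G : ℝ → ℂ, (∀ s, 0 < s → G (h s) = q s) ∧
      (∀ t : ℝ, 0 < t → ∃ ψ : ℂ → ℂ, AnalyticAt ℂ ψ t ∧ ∀ᶠ t' : ℝ in 𝓝 t, G t' = ψ t') ∧
      (∃ η : ℝ, 0 < η ∧ ∀ t, 0 < t → t < η → G t = P t) ∧
      ∀ T : ℝ → ℂ, (IntegrableOn T (Ioi 0) ↔ IntegrableOn (fun s => h' s • T (h s)) (Ioi 0)) ∧
        ∫ t in Ioi (0 : ℝ), T t = ∫ s in Ioi (0 : ℝ), h' s • T (h s) := by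
  have hcont : Continuous h := continuous_iff_continuousAt.2 fun s => (hd s).hasDerivAt.continuousAt
  have hpos' : ∀ s, 0 < s → 0 < h' s := by
    rcases hasDerivWithinAt_forall_lt_or_forall_gt_of_forall_ne (convex_Ioi (0 : ℝ))
      (fun s _ => (hd s).hasDerivAt.hasDerivWithinAt) (m := 0) hne with hlt | hgt
    · exfalso
      have hanti : StrictAntiOn h (Ici 0) :=
        strictAntiOn_of_deriv_neg (convex_Ici 0) hcont.continuousOn fun s hs => by
          rw [interior_Ici] at hs
          rw [(hd s).hasDerivAt.deriv]
          exact hlt s hs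
      have := hanti self_mem_Ici (mem_Ici.2 zero_le_one) one_pos
      linarith [hnn 1]
    · exact hgt
  have hmono : StrictMonoOn h (Ici 0) :=
    strictMonoOn_of_deriv_pos (convex_Ici 0) hcont.continuousOn fun s hs => by
      rw [interior_Ici] at hs
      rw [(hd s).hasDerivAt.deriv]
      exact hpos' s hs
  have hpos : ∀ s, 0 < s → 0 < h s := fun s hs => h0 ▸ hmono self_mem_Ici hs.le hs
  have hinj : InjOn h (Ioi 0) := hmono.injOn.mono Ioi_subset_Ici_self
  have hsurj : ∀ t, 0 < t → ∃ s, 0 < s ∧ h s = t := fun t ht => by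
    obtain ⟨b, hb, hb0⟩ := ((hlim.eventually_ge_atTop t).and (eventually_ge_atTop 0)).exists
    obtain ⟨s, hs, hst⟩ := intermediate_value_Icc hb0 hcont.continuousOn ⟨h0.trans_le ht.le, hb⟩
    refine ⟨s, hs.1.lt_of_ne fun h => ?_, hst⟩
    rw [← h, h0] at hst
    exact ht.ne hst
  have himage : h '' Ioi 0 = Ioi 0 :=
    Subset.antisymm (by rintro _ ⟨s, hs, rfl⟩; exact hpos s hs) fun t ht => hsurj t ht
  let G : ℝ → ℂ := q ∘ Function.invFunOn h (Ioi 0)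
  have hG : ∀ s, 0 < s → G (h s) = q s := fun s hs =>
    congrArg q (hinj.leftInvOn_invFunOn hs)
  refine ⟨G, hG, fun t ht => ?_, ⟨h r, hpos r hr, fun t ht htr => ?_⟩, fun T => ?_⟩
  · obtain ⟨s, hs, rfl⟩ := hsurj t ht
    obtain ⟨ψ, hψ, hq⟩ := hloc s hs
    refine ⟨ψ, hψ, ?_⟩
    -- A nonzero strict derivative makes `h` map neighbourhoods of `s` onto neighbourhoods of `h s`.
    rw [← (hd s).map_nhds_eq (hne s hs), eventually_map]
    filter_upwards [hq, Ioi_mem_nhds hs] with s' h1 h2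
    rw [hG s' h2, h1]
  · obtain ⟨s, hs, rfl⟩ := hsurj t ht
    rw [hG s hs, hP s hs ((hmono.lt_iff_lt hs.le hr.le).1 htr)]
  · have habs : EqOn (fun s => |h' s| • T (h s)) (fun s => h' s • T (h s)) (Ioi 0) :=
      fun s hs => by simp only [abs_of_pos (hpos' s hs)]
    have hdw : ∀ s ∈ Ioi (0 : ℝ), HasDerivWithinAt h (h' s) (Ioi 0) s :=
      fun s _ => (hd s).hasDerivAt.hasDerivWithinAt
    constructor
    · rw [← integrableOn_congr_fun habs measurableSet_Ioi,
        ← integrableOn_image_iff_integrableOn_abs_deriv_smul measurableSet_Ioi hdw hinj, himage]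
    · rw [← setIntegral_congr_fun measurableSet_Ioi habs,
        ← integral_image_eq_integral_abs_deriv_smul measurableSet_Ioi hdw hinj, himage]

/-! ### Morse coordinates in one variable -/

/-- Normalizing by `q w₀` puts the argument of the principal root near `1`, away from the cut; the
squared identity needs no branch and holds everywhere. -/
theorem exists_analytic_sqrt {q : ℂ → ℂ} {w₀ : ℂ} (hq : AnalyticAt ℂ q w₀) (h0 : q w₀ ≠ 0) :
    ∃ S : ℂ → ℂ, AnalyticAt ℂ S w₀ ∧ S w₀ ≠ 0 ∧ ∀ w, S w ^ 2 = q w := by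
  have hsq : ∀ x : ℂ, (x ^ (1 / 2 : ℂ)) ^ 2 = x := fun x => by
    rw [← cpow_nat_mul]; norm_num
  refine ⟨fun w => q w₀ ^ (1 / 2 : ℂ) * (q w / q w₀) ^ (1 / 2 : ℂ), ?_, ?_, fun w => ?_⟩
  · refine analyticAt_const.mul ((hq.div analyticAt_const h0).cpow analyticAt_const ?_)
    simp [h0]
  · simp [h0]
  · rw [mul_pow, hsq, hsq, mul_div_cancel₀ _ h0]

/-- Two divided differences give `F - F w₀ = (w - w₀)² q` with `q` analytic. Were `q w₀` zero, the
second derivative would vanish; so `q` has a root `S`, and `W = (w - w₀) S`. -/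
theorem exists_morse_coordinate {F : ℂ → ℂ} {w₀ : ℂ} (hF : AnalyticAt ℂ F w₀)
    (h1 : deriv F w₀ = 0) (h2 : iteratedDeriv 2 F w₀ ≠ 0) :
    ∃ W : ℂ → ℂ, AnalyticAt ℂ W w₀ ∧ W w₀ = 0 ∧ deriv W w₀ ≠ 0 ∧ ∀ w, W w ^ 2 = F w - F w₀ := by
  have hdslope : ∀ {f : ℂ → ℂ}, AnalyticAt ℂ f w₀ → AnalyticAt ℂ (dslope f w₀) w₀ :=
    fun ⟨p, hp⟩ => ⟨_, hp.has_fpower_series_dslope_fslope⟩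
  set q : ℂ → ℂ := dslope (dslope F w₀) w₀ with hq
  have hqa : AnalyticAt ℂ q w₀ := hdslope (hdslope hF)
  have hFq : ∀ w, F w - F w₀ = (w - w₀) ^ 2 * q w := fun w => by
    have e1 := sub_smul_dslope F w₀ w
    have e2 := sub_smul_dslope (dslope F w₀) w₀ w
    rw [dslope_same, h1, sub_zero] at e2
    rw [← e1, ← e2, smul_eq_mul, smul_eq_mul, hq]
    ring
  have hq0 : q w₀ ≠ 0 := by
    intro h0
    refine h2 ?_
    have hd1 : deriv F =ᶠ[𝓝 w₀] fun w => 2 * (w - w₀) * q w + (w - w₀) ^ 2 * deriv q w := by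
      filter_upwards [hqa.eventually_analyticAt] with w hw
      have heq : F = fun w => F w₀ + (w - w₀) ^ 2 * q w := by
        funext w
        rw [← hFq]; ring
      have := (((((hasDerivAt_id w).sub_const w₀).pow 2).mul hw.differentiableAt.hasDerivAt)).const_add
        (F w₀)
      rw [heq]
      refine HasDerivAt.deriv ?_
      convert! this using 1
      simp
    rw [iteratedDeriv_succ, iteratedDeriv_one, hd1.deriv_eq]
    have hA : HasDerivAt (fun w : ℂ => 2 * (w - w₀)) 2 w₀ := by
      simpa using ((hasDerivAt_id w₀).sub_const w₀).const_mul 2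
    have hB : HasDerivAt (fun w : ℂ => (w - w₀) ^ 2) 0 w₀ := by
      simpa using ((hasDerivAt_id w₀).sub_const w₀).fun_pow 2
    have := (hA.mul hqa.differentiableAt.hasDerivAt).add
      (hB.mul hqa.deriv.differentiableAt.hasDerivAt)
    refine (HasDerivAt.deriv this).trans ?_
    simp [h0]
  obtain ⟨S, hS, hS0, hSq⟩ := exists_analytic_sqrt hqa hq0
  have hlin : AnalyticAt ℂ (fun w : ℂ => w - w₀) w₀ := analyticAt_id.sub analyticAt_const
  refine ⟨fun w => (w - w₀) * S w, hlin.mul hS, by simp, ?_, fun w => by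
    rw [mul_pow, hSq, hFq]⟩
  have := ((hasDerivAt_id w₀).sub_const w₀).mul hS.differentiableAt.hasDerivAt
  have h3 : deriv (fun w => (w - w₀) * S w) w₀ = S w₀ := by
    refine (HasDerivAt.deriv this).trans ?_
    simp
  rw [h3]
  exact hS0

/-- Take `ψ` to be `g` composed with the local inverse of `f`. It is used with `f` itself off the
critical points and with the Morse coordinate `W` at `a`. -/
theorem exists_analytic_factor {f g : ℂ → ℂ} {w₀ : ℂ} (hf : AnalyticAt ℂ f w₀)
    (hf' : deriv f w₀ ≠ 0) (hg : AnalyticAt ℂ g w₀) :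
    ∃ ψ : ℂ → ℂ, AnalyticAt ℂ ψ (f w₀) ∧ ∀ᶠ w in 𝓝 w₀, g w = ψ (f w) := by
  let R := hf.hasStrictDerivAt.localInverse f (deriv f w₀) w₀ hf'
  have hR : AnalyticAt ℂ R (f w₀) := hf.analyticAt_localInverse hf'
  have hleft : ∀ᶠ w in 𝓝 w₀, R (f w) = w :=
    HasStrictDerivAt.eventually_left_inverse hf.hasStrictDerivAt hf'
  have hR0 : R (f w₀) = w₀ := hleft.self_of_nhds
  refine ⟨g ∘ R, AnalyticAt.comp (by rwa [hR0]) hR, hleft.mono fun w hw => ?_⟩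
  rw [Function.comp_apply, hw]

section Manifold

variable {X : Type*} [TopologicalSpace X] [ChartedSpace ℂ X]

/-! ### The quotient of a one-form by the differential of a function -/

/-- The differential of `f` at `x`, read as a linear form on `ℂ`. -/
def differential (f : X → ℂ) (x : X) : ℂ →L[ℂ] ℂ := mfderiv 𝓘(ℂ) 𝓘(ℂ) f x

/-- The value of the form `ν` at `x`, read as a linear form on `ℂ`. -/
def formAt (ν : (x : X) → TangentSpace 𝓘(ℂ) x →L[ℂ] ℂ) (x : X) : ℂ →L[ℂ] ℂ := ν x

/-- The velocity of a curve, read as a complex number. -/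
def complexVelocity (γ : ℝ → X) (s : ℝ) : ℂ := velocity γ s

/-- The differential of the inverse of the chart at `x₀`, read as a linear form on `ℂ`. -/
def chartSymmDifferential (x₀ : X) (w : ℂ) : ℂ →L[ℂ] ℂ :=
  mfderiv 𝓘(ℂ) 𝓘(ℂ) (extChartAt 𝓘(ℂ) x₀).symm w

/-- The quotient of the form `ν` by the differential of `f`, a function off the critical points
of `f`. -/
def formRatio (f : X → ℂ) (ν : (x : X) → TangentSpace 𝓘(ℂ) x →L[ℂ] ℂ) (x : X) : ℂ :=
  formAt ν x 1 / differential f x 1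

theorem linearForm_apply (L : ℂ →L[ℂ] ℂ) (v : ℂ) : L v = v * L 1 := by
  simpa using L.map_smul v 1

theorem differential_one_ne_zero {f : X → ℂ} {x : X} (hx : ¬ IsCriticalPoint f x) :
    differential f x 1 ≠ 0 := fun h => hx <| by
  have h0 : differential f x = 0 := ContinuousLinearMap.ext fun v => by
    rw [linearForm_apply, h, mul_zero]
    rfl
  exact h0

theorem formRatio_eq {f : X → ℂ} {ν : (x : X) → TangentSpace 𝓘(ℂ) x →L[ℂ] ℂ} (x : X) {v : ℂ}
    (hv : v ≠ 0) : formRatio f ν x = formAt ν x v / differential f x v := by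
  rw [linearForm_apply (formAt ν x) v, linearForm_apply (differential f x) v, formRatio,
    mul_div_mul_left _ _ hv]

theorem formAt_eq_formRatio_mul {f : X → ℂ} {ν : (x : X) → TangentSpace 𝓘(ℂ) x →L[ℂ] ℂ}
    {x : X} (hx : ¬ IsCriticalPoint f x) (v : ℂ) :
    formAt ν x v = formRatio f ν x * differential f x v := by
  have h1 := differential_one_ne_zero hx
  rw [linearForm_apply (formAt ν x) v, linearForm_apply (differential f x) v, formRatio]
  field_simp

theorem deriv_comp_extChartAt_symm_self {f : X → ℂ} (hf : MDifferentiable 𝓘(ℂ) 𝓘(ℂ) f) (x₀ : X) :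
    deriv (f ∘ (extChartAt 𝓘(ℂ) x₀).symm) (extChartAt 𝓘(ℂ) x₀ x₀) = differential f x₀ 1 := by
  rw [differential, (hf x₀).mfderiv, ModelWithCorners.range_eq_univ, fderivWithin_univ]
  rfl

/-- Chart-local statements near `x₀` translate to the manifold. -/
theorem eventually_of_extChartAt {x₀ : X} {p : X → ℂ → Prop}
    (h : ∀ᶠ w in 𝓝 (extChartAt 𝓘(ℂ) x₀ x₀), p ((extChartAt 𝓘(ℂ) x₀).symm w) w) :
    ∀ᶠ x in 𝓝 x₀, p x (extChartAt 𝓘(ℂ) x₀ x) := by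
  filter_upwards [(continuousAt_extChartAt (I := 𝓘(ℂ)) x₀).eventually h,
    extChartAt_source_mem_nhds (I := 𝓘(ℂ)) x₀] with x hx hxs
  rwa [(extChartAt 𝓘(ℂ) x₀).left_inv hxs] at hx

theorem hasStrictDerivAt_extChartAt_comp {γ : ℝ → X} (hγ : ContMDiff 𝓘(ℝ, ℝ) 𝓘(ℝ, ℂ) 1 γ) (s : ℝ) :
    HasStrictDerivAt (extChartAt 𝓘(ℂ) (γ s) ∘ γ) (complexVelocity γ s) s := by
  have h1 : ContDiffAt ℝ 1 (extChartAt 𝓘(ℂ) (γ s) ∘ γ) s := by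
    have := (contMDiffAt_iff.1 (hγ s)).2
    rw [ModelWithCorners.range_eq_univ, contDiffWithinAt_univ] at this
    exact this
  have h2 : complexVelocity γ s = deriv (extChartAt 𝓘(ℂ) (γ s) ∘ γ) s := by
    have hmd : MDifferentiableAt 𝓘(ℝ, ℝ) 𝓘(ℝ, ℂ) γ s := (hγ s).mdifferentiableAt one_ne_zero
    rw [complexVelocity, velocity, hmd.mfderiv, ModelWithCorners.range_eq_univ, fderivWithin_univ]
    rfl
  rw [h2]
  exact h1.hasStrictDerivAt one_ne_zero

variable [IsManifold 𝓘(ℂ) 1 X]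

theorem mdifferentiableAt_extChartAt_symm_complex {x₀ : X} {w : ℂ}
    (hw : w ∈ (extChartAt 𝓘(ℂ) x₀).target) :
    MDifferentiableAt 𝓘(ℂ) 𝓘(ℂ) (extChartAt 𝓘(ℂ) x₀).symm w := by
  have := mdifferentiableWithinAt_extChartAt_symm (I := 𝓘(ℂ)) hw
  rwa [ModelWithCorners.range_eq_univ, mdifferentiableWithinAt_univ] at this

theorem chartSymmDifferential_one_ne_zero {x₀ : X} {w : ℂ}
    (hw : w ∈ (extChartAt 𝓘(ℂ) x₀).target) : chartSymmDifferential x₀ w 1 ≠ 0 := by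
  have h := isInvertible_mfderivWithin_extChartAt_symm (I := 𝓘(ℂ)) hw
  rw [ModelWithCorners.range_eq_univ, mfderivWithin_univ] at h
  have hinj : Function.Injective (chartSymmDifferential x₀ w) := h.injective
  exact fun h0 => one_ne_zero (hinj (h0.trans (map_zero _).symm))

theorem hasDerivAt_comp_extChartAt_symm {f : X → ℂ} (hf : MDifferentiable 𝓘(ℂ) 𝓘(ℂ) f) {x₀ : X}
    {w : ℂ} (hw : w ∈ (extChartAt 𝓘(ℂ) x₀).target) :
    HasDerivAt (f ∘ (extChartAt 𝓘(ℂ) x₀).symm)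
      (differential f ((extChartAt 𝓘(ℂ) x₀).symm w) (chartSymmDifferential x₀ w 1)) w := by
  have h1 := (hf ((extChartAt 𝓘(ℂ) x₀).symm w)).hasMFDerivAt
  have h2 := (mdifferentiableAt_extChartAt_symm_complex hw).hasMFDerivAt
  have h3 : HasFDerivAt (f ∘ (extChartAt 𝓘(ℂ) x₀).symm)
      ((differential f ((extChartAt 𝓘(ℂ) x₀).symm w)).comp (chartSymmDifferential x₀ w)) w :=
    (h1.comp w h2).hasFDerivAt
  exact h3.hasDerivAt

theorem analyticAt_comp_extChartAt_symm {f : X → ℂ} (hf : MDifferentiable 𝓘(ℂ) 𝓘(ℂ) f) {x₀ : X}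
    {w : ℂ} (hw : w ∈ (extChartAt 𝓘(ℂ) x₀).target) :
    AnalyticAt ℂ (f ∘ (extChartAt 𝓘(ℂ) x₀).symm) w :=
  DifferentiableOn.analyticAt
    (fun _ hv => (hasDerivAt_comp_extChartAt_symm hf hv).differentiableAt.differentiableWithinAt)
    ((isOpen_extChartAt_target (I := 𝓘(ℂ)) x₀).mem_nhds hw)

/-- In a chart, `ν / df` is the quotient of holomorphic functions. -/
theorem exists_formRatio_extChartAt_symm {f : X → ℂ} (hf : MDifferentiable 𝓘(ℂ) 𝓘(ℂ) f)
    {ν : (x : X) → TangentSpace 𝓘(ℂ) x →L[ℂ] ℂ} (hν : IsHolomorphicOneForm ν) (x₀ : X) :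
    ∃ g : ℂ → ℂ, AnalyticAt ℂ g (extChartAt 𝓘(ℂ) x₀ x₀) ∧
      ∀ w ∈ (extChartAt 𝓘(ℂ) x₀).target, formRatio f ν ((extChartAt 𝓘(ℂ) x₀).symm w) =
        g w / deriv (f ∘ (extChartAt 𝓘(ℂ) x₀).symm) w := by
  refine ⟨_, DifferentiableOn.analyticAt (hν x₀) ((isOpen_extChartAt_target (I := 𝓘(ℂ)) x₀).mem_nhds
    (mem_extChartAt_target x₀)), fun w hw => ?_⟩
  rw [(hasDerivAt_comp_extChartAt_symm hf hw).deriv]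
  exact formRatio_eq _ (chartSymmDifferential_one_ne_zero hw)

theorem exists_formRatio_eq_comp {f : X → ℂ} (hf : MDifferentiable 𝓘(ℂ) 𝓘(ℂ) f)
    {ν : (x : X) → TangentSpace 𝓘(ℂ) x →L[ℂ] ℂ} (hν : IsHolomorphicOneForm ν) {x₀ : X}
    (hx₀ : ¬ IsCriticalPoint f x₀) :
    ∃ ψ : ℂ → ℂ, AnalyticAt ℂ ψ (f x₀) ∧ ∀ᶠ x in 𝓝 x₀, formRatio f ν x = ψ (f x) := by
  obtain ⟨g, hg, hratio⟩ := exists_formRatio_extChartAt_symm hf hν x₀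
  have hF := analyticAt_comp_extChartAt_symm hf (mem_extChartAt_target (I := 𝓘(ℂ)) x₀)
  have hF' : deriv (f ∘ (extChartAt 𝓘(ℂ) x₀).symm) (extChartAt 𝓘(ℂ) x₀ x₀) ≠ 0 := by
    rw [deriv_comp_extChartAt_symm_self hf]
    exact differential_one_ne_zero hx₀
  obtain ⟨ψ, hψ, hψg⟩ := exists_analytic_factor hF hF' (hg.div hF.deriv hF')
  refine ⟨ψ, by simpa using hψ,
    eventually_of_extChartAt (p := fun x _ => formRatio f ν x = ψ (f x)) ?_⟩
  filter_upwards [hψg, (isOpen_extChartAt_target x₀).mem_nhds (mem_extChartAt_target x₀)]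
    with w h1 h2
  rw [hratio w h2]
  exact h1

/-- From `f - f a = W²` comes `df = 2 W dW`; thus `ν/df` is `g / (2 W')` divided by `W`, and that
numerator is a function of the coordinate `W`. -/
theorem exists_formRatio_eq_div {f : X → ℂ} (hf : MDifferentiable 𝓘(ℂ) 𝓘(ℂ) f)
    {ν : (x : X) → TangentSpace 𝓘(ℂ) x →L[ℂ] ℂ} (hν : IsHolomorphicOneForm ν) {a : X}
    (ha : IsNondegenerateCriticalPoint f a) :
    ∃ W k : ℂ → ℂ, AnalyticAt ℂ W (extChartAt 𝓘(ℂ) a a) ∧ W (extChartAt 𝓘(ℂ) a a) = 0 ∧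
      deriv W (extChartAt 𝓘(ℂ) a a) ≠ 0 ∧ AnalyticAt ℂ k 0 ∧
      ∀ᶠ x in 𝓝 a, W (extChartAt 𝓘(ℂ) a x) ^ 2 = f x - f a ∧
        formRatio f ν x = k (W (extChartAt 𝓘(ℂ) a x)) / W (extChartAt 𝓘(ℂ) a x) := by
  obtain ⟨g, hg, hratio⟩ := exists_formRatio_extChartAt_symm hf hν a
  have hF := analyticAt_comp_extChartAt_symm hf (mem_extChartAt_target (I := 𝓘(ℂ)) a)
  have hF' : deriv (f ∘ (extChartAt 𝓘(ℂ) a).symm) (extChartAt 𝓘(ℂ) a a) = 0 := by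
    rw [deriv_comp_extChartAt_symm_self hf]
    have h0 : differential f a = 0 := ha.1
    rw [h0]
    rfl
  obtain ⟨W, hW, hW0, hW', hW2⟩ := exists_morse_coordinate hF hF' ha.2
  obtain ⟨k, hk, hkg⟩ := exists_analytic_factor hW hW'
    (hg.div (analyticAt_const.mul hW.deriv) (mul_ne_zero two_ne_zero hW'))
  refine ⟨W, k, hW, hW0, hW', hW0 ▸ hk, eventually_of_extChartAt
    (p := fun x w => W w ^ 2 = f x - f a ∧ formRatio f ν x = k (W w) / W w) ?_⟩
  -- The point `a` need not be excluded: there both quotients have denominator `0` and take the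
  -- value `0`.
  filter_upwards [hkg, hW.eventually_analyticAt,
    (isOpen_extChartAt_target (I := 𝓘(ℂ)) a).mem_nhds (mem_extChartAt_target a)] with w h1 h2 h3
  refine ⟨by rw [hW2, Function.comp_apply, Function.comp_apply, extChartAt_to_inv], ?_⟩
  have hd : deriv (f ∘ (extChartAt 𝓘(ℂ) a).symm) w = 2 * W w * deriv W w := by
    have heq : f ∘ (extChartAt 𝓘(ℂ) a).symm =
        fun w => W w ^ 2 + (f ∘ (extChartAt 𝓘(ℂ) a).symm) (extChartAt 𝓘(ℂ) a a) := by
      funext w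
      rw [hW2]; ring
    rw [heq]
    refine ((h2.differentiableAt.hasDerivAt.fun_pow 2).add_const _).deriv.trans ?_
    simp
  rw [hratio w h3, hd, ← h1, Pi.div_apply, Pi.mul_apply, div_div]
  congr 1
  ring

theorem hasStrictDerivAt_comp_curve {f : X → ℂ} (hf : MDifferentiable 𝓘(ℂ) 𝓘(ℂ) f) {γ : ℝ → X}
    (hγ : ContMDiff 𝓘(ℝ, ℝ) 𝓘(ℝ, ℂ) 1 γ) (s : ℝ) :
    HasStrictDerivAt (f ∘ γ) (differential f (γ s) (complexVelocity γ s)) s := by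
  have hF := analyticAt_comp_extChartAt_symm hf (mem_extChartAt_target (I := 𝓘(ℂ)) (γ s))
  have h := HasStrictDerivAt.scomp s hF.hasStrictDerivAt (hasStrictDerivAt_extChartAt_comp hγ s)
  have hv : complexVelocity γ s • deriv (f ∘ (extChartAt 𝓘(ℂ) (γ s)).symm)
      (extChartAt 𝓘(ℂ) (γ s) (γ s)) = (differential f (γ s) (complexVelocity γ s)) := by
    rw [deriv_comp_extChartAt_symm_self hf]
    exact (linearForm_apply _ _).symm
  rw [hv] at h
  refine h.congr_of_eventuallyEq ?_
  filter_upwards [hγ.continuous.continuousAt.eventually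
    (extChartAt_source_mem_nhds (I := 𝓘(ℂ)) (γ s))] with s' hs'
  simp only [Function.comp_apply]
  rw [(extChartAt 𝓘(ℂ) (γ s)).left_inv hs']

end Manifold

/-! ### The height along the thimble -/

theorem tendsto_height {F : ℝ → ℂ} {h : ℝ → ℝ} {α : ℂ} {θ : ℝ} {l : Filter ℝ}
    (hh : ∀ s, 0 ≤ h s ∧ F s = α + h s * exp (θ * I))
    (hl : Tendsto (fun s => ‖F s‖) l atTop) : Tendsto h l atTop := by
  refine tendsto_atTop_mono (fun s => ?_) (tendsto_atTop_add_const_right l (-‖α‖) hl)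
  have := norm_add_le α (h s * exp (θ * I))
  rw [← (hh s).2, norm_mul, norm_exp_ofReal_mul_I, mul_one, norm_real,
    Real.norm_of_nonneg (hh s).1] at this
  linarith

section Manifold

variable {X : Type*} [TopologicalSpace X] [ChartedSpace ℂ X] {f : X → ℂ} {a : X} {θ : ℝ}
  {γ : ℝ → X} {h : ℝ → ℝ}

theorem IsOrientedThimble.exists_height (hγ : IsOrientedThimble f a θ γ) :
    ∃ h : ℝ → ℝ, ∀ s, 0 ≤ h s ∧ f (γ s) = f a + h s * exp (θ * I) := by
  have : ∀ s, ∃ t : ℝ, 0 ≤ t ∧ f (γ s) = f a + t * exp (θ * I) := fun s =>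
    connectedComponentIn_subset (f ⁻¹' ray (f a) θ) a
      (hγ.range_eq ▸ mem_range_self s : γ s ∈ thimble f a θ)
  exact ⟨_, fun s => (this s).choose_spec⟩

theorem IsOrientedThimble.not_isCriticalPoint (hγ : IsOrientedThimble f a θ γ) {s : ℝ}
    (hs : s ≠ 0) : ¬ IsCriticalPoint f (γ s) := fun hc => hs <| hγ.injective <| by
  rw [hγ.map_zero]
  exact hγ.eq_of_critical _ (hγ.range_eq ▸ mem_range_self s) hc

/-- The integrands at `z'` and `z` differ by `e^{-(z'-z)f}`, which is bounded on the thimble since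
`f - f a` is a nonnegative multiple of `e^{iθ}`. -/
theorem ThimbleIntegrable.mono_re (hf : MDifferentiable 𝓘(ℂ) 𝓘(ℂ) f)
    {ν : (x : X) → TangentSpace 𝓘(ℂ) x →L[ℂ] ℂ} (hγ : IsOrientedThimble f a θ γ) {z z' : ℂ}
    (hz : ThimbleIntegrable f ν γ z) (hzz' : (z * exp (θ * I)).re ≤ (z' * exp (θ * I)).re) :
    ThimbleIntegrable f ν γ z' := by
  obtain ⟨h, hh⟩ := hγ.exists_height
  have hc : Continuous fun s => exp (-((z' - z) * f (γ s))) := by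
    have : Continuous fun s => f (γ s) := hf.continuous.comp hγ.contMDiff.continuous
    exact continuous_exp.comp (continuous_const.mul this).neg
  refine (Integrable.bdd_mul (c := Real.exp (-((z' - z) * f a).re)) hz hc.aestronglyMeasurable
    (Eventually.of_forall fun s => ?_)).congr (Eventually.of_forall fun s => ?_)
  · rw [norm_exp, (hh s).2]
    refine Real.exp_le_exp.2 ?_
    have h1 : -((z' - z) * (f a + h s * exp (θ * I))) =
        -((z' - z) * f a) - h s * (z' * exp (θ * I) - z * exp (θ * I)) := by ring
    rw [h1, sub_re, re_ofReal_mul, neg_re, sub_re]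
    have := mul_nonneg (hh s).1 (sub_nonneg.2 hzz')
    linarith
  · simp only [thimbleIntegrand]
    rw [← mul_assoc, ← exp_add]
    ring_nf

variable [IsManifold 𝓘(ℂ) 1 X]

/-- The height is the real part of `e^{-iθ}(f ∘ γ - f a)`, so it inherits strict differentiability.
Its derivative vanishes only where `df` kills the nonzero velocity, that is, at a critical point. -/
theorem exists_hasStrictDerivAt_height (hf : MDifferentiable 𝓘(ℂ) 𝓘(ℂ) f)
    (hγ : IsOrientedThimble f a θ γ)
    (hh : ∀ s, 0 ≤ h s ∧ f (γ s) = f a + h s * exp (θ * I)) :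
    ∃ h' : ℝ → ℝ, (∀ s, HasStrictDerivAt h (h' s) s) ∧ (∀ s, s ≠ 0 → h' s ≠ 0) ∧
      ∀ s, differential f (γ s) (complexVelocity γ s) = h' s * exp (θ * I) := by
  set u : ℂ := exp (θ * I) with hu
  have hu0 : u ≠ 0 := exp_ne_zero _
  have hd := hasStrictDerivAt_comp_curve hf hγ.contMDiff
  have hre : h = fun s => reCLM (u⁻¹ * ((f ∘ γ) s - f a)) := by
    funext s
    rw [Function.comp_apply, (hh s).2, add_sub_cancel_left, mul_comm, mul_assoc,
      mul_inv_cancel₀ hu0]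
    simp
  have hs : ∀ s, HasStrictDerivAt h
      (reCLM (u⁻¹ * differential f (γ s) (complexVelocity γ s))) s := fun s => by
    have h1 : HasStrictDerivAt (fun s => (f ∘ γ) s - f a)
        (differential f (γ s) (complexVelocity γ s)) s := (hd s).sub_const (f a)
    rw [hre]
    exact reCLM.hasStrictFDerivAt.comp_hasStrictDerivAt s (HasStrictDerivAt.const_mul u⁻¹ h1)
  have heq : ∀ s, differential f (γ s) (complexVelocity γ s) =
      (reCLM (u⁻¹ * differential f (γ s) (complexVelocity γ s)) : ℝ) * u := fun s => by
    have h1 : f ∘ γ = fun s => f a + h s * u := funext fun s => (hh s).2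
    have h2 := ((hs s).hasDerivAt.ofReal_comp.mul_const u).const_add (f a)
    have h3 := (hd s).hasDerivAt
    rw [h1] at h3
    exact h3.unique h2
  refine ⟨_, hs, fun s hs0 h0 => ?_, heq⟩
  have h1 := heq s
  rw [h0, ofReal_zero, zero_mul, linearForm_apply] at h1
  have hv : complexVelocity γ s ≠ 0 := hγ.velocity_ne_zero s
  exact mul_ne_zero hv
    (differential_one_ne_zero (hγ.not_isCriticalPoint hs0)) h1

/-- Near the critical point, the two halves of the thimble are the two branches of a square
root. -/
theorem exists_formRatio_branches (hf : MDifferentiable 𝓘(ℂ) 𝓘(ℂ) f)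
    {ν : (x : X) → TangentSpace 𝓘(ℂ) x →L[ℂ] ℂ} (hν : IsHolomorphicOneForm ν)
    (hγ : IsOrientedThimble f a θ γ)
    (hh : ∀ s, 0 ≤ h s ∧ f (γ s) = f a + h s * exp (θ * I)) :
    ∃ κ : ℂ → ℂ, AnalyticAt ℂ κ 0 ∧ ∀ᶠ s in 𝓝 (0 : ℝ),
      (0 < s → formRatio f ν (γ s) = κ (√(h s) : ℝ) / (√(h s) : ℝ)) ∧
      (s < 0 → formRatio f ν (γ s) = κ (-(√(h s) : ℝ)) / -(√(h s) : ℝ)) := by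
  obtain ⟨W, k, hW, hW0, hW', hk, hWk⟩ := exists_formRatio_eq_div hf hν hγ.nondegenerate
  have h0 := hγ.map_zero
  subst h0
  set y : ℝ → ℂ := fun s => W (extChartAt 𝓘(ℂ) (γ 0) (γ s)) with hy
  set c : ℂ := complexVelocity γ 0 • deriv W (extChartAt 𝓘(ℂ) (γ 0) (γ 0)) with hc
  have hc0 : c ≠ 0 := smul_ne_zero (hγ.velocity_ne_zero 0) hW'
  have hyd : HasDerivAt y c 0 :=
    HasDerivAt.scomp (0 : ℝ) hW.differentiableAt.hasDerivAt
      (hasStrictDerivAt_extChartAt_comp hγ.contMDiff 0).hasDerivAt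
  have hev := hγ.contMDiff.continuous.continuousAt.eventually hWk
  -- For either root `σ` of `e^{iθ}`, `(W/σ)² = h` along the curve.
  have hsqrt : ∀ σ : ℂ, σ ^ 2 = exp (θ * I) → ∀ᶠ s in 𝓝 (0 : ℝ),
      y s / σ = (√(h s) : ℝ) ∨ y s / σ = -(√(h s) : ℝ) := fun σ hσ => by
    filter_upwards [hev] with s hs
    rw [← sq_eq_sq_iff_eq_or_eq_neg, div_pow, hσ, ← ofReal_pow, Real.sq_sqrt (hh s).1]
    refine (div_eq_iff (exp_ne_zero _)).2 ?_
    rw [hy, hs.1, (hh s).2]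
    ring
  have hder : ∀ σ : ℂ, HasDerivAt (fun s => y s / σ) (c / σ) 0 := fun σ => hyd.div_const σ
  -- If `W/σ` has positive derivative at `s = 0`, its sign is that of `s`, which decides between
  -- `√h` and `-√h` on each half.
  have main : ∀ σ : ℂ, σ ^ 2 = exp (θ * I) → 0 < (c / σ).re →
      ∃ κ : ℂ → ℂ, AnalyticAt ℂ κ 0 ∧ ∀ᶠ s in 𝓝 (0 : ℝ),
      (0 < s → formRatio f ν (γ s) = κ (√(h s) : ℝ) / (√(h s) : ℝ)) ∧
      (s < 0 → formRatio f ν (γ s) = κ (-(√(h s) : ℝ)) / -(√(h s) : ℝ)) := by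
    intro σ hσ hpos
    have hσ0 : σ ≠ 0 := fun h => exp_ne_zero (θ * I) (by rw [← hσ, h]; simp)
    have hxd : HasDerivAt (fun s => (y s / σ).re) (c / σ).re 0 :=
      (reCLM.hasFDerivAt.comp_hasDerivAt (0 : ℝ) (hder σ) :)
    have hsign := eventually_nhdsWithin_sign_eq_of_deriv_pos (f := fun s => (y s / σ).re)
      (by rw [hxd.deriv]; exact hpos) (by change (W _ / σ).re = 0; rw [hW0]; simp)
    refine ⟨fun v => k (σ * v) / σ, ?_, ?_⟩
    · refine AnalyticAt.div (AnalyticAt.comp (by simpa using hk)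
        (analyticAt_const.mul analyticAt_id)) analyticAt_const hσ0
    filter_upwards [hev, hsqrt σ hσ, hsign] with s h1 h2 h3
    have hratio : ∀ v : ℂ, y s / σ = v → formRatio f ν (γ s) = k (σ * v) / σ / v := by
      intro v hv
      have hyv : y s = σ * v := by rw [← hv, mul_div_cancel₀ _ hσ0]
      rw [h1.2, div_div, ← hyv]
    rw [sub_zero] at h3
    have hnn := Real.sqrt_nonneg (h s)
    refine ⟨fun hs => hratio _ ?_, fun hs => hratio _ ?_⟩
    · rcases h2 with h2 | h2
      · exact h2
      · rw [sign_pos hs, sign_eq_one_iff, h2, neg_re, ofReal_re] at h3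
        linarith
    · rcases h2 with h2 | h2
      · rw [sign_neg hs, sign_eq_neg_one_iff, h2, ofReal_re] at h3
        linarith
      · exact h2
  set ω : ℂ := exp (θ / 2 * I) with hω
  have hω2 : ω ^ 2 = exp (θ * I) := by
    rw [hω, ← exp_nat_mul]; push_cast; ring_nf
  -- `W/ω` is real near `0`, hence so is its derivative; being nonzero, it is positive for one of
  -- the roots `ω`, `-ω`.
  have him : (c / ω).im = 0 := by
    have hd : HasDerivAt (fun s => (y s / ω).im) (c / ω).im 0 :=
      (imCLM.hasFDerivAt.comp_hasDerivAt (0 : ℝ) (hder ω) :)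
    refine hd.unique ((hasDerivAt_const (0 : ℝ) (0 : ℝ)).congr_of_eventuallyEq ?_)
    filter_upwards [hsqrt ω hω2] with s hs
    rcases hs with hs | hs <;> rw [hs] <;> simp
  have hre : (c / ω).re ≠ 0 := fun hre =>
    div_ne_zero hc0 (exp_ne_zero _) (Complex.ext (by simpa using hre) (by simpa using him))
  rcases hre.lt_or_gt with hlt | hgt
  · refine main (-ω) (by rw [neg_sq, hω2]) ?_
    rw [div_neg, neg_re]
    linarith
  · exact main ω hω2 hgt

/-- The thimble integral as a Laplace integral along the ray. -/
theorem exists_laplace_representation (hf : MDifferentiable 𝓘(ℂ) 𝓘(ℂ) f)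
    {ν : (x : X) → TangentSpace 𝓘(ℂ) x →L[ℂ] ℂ} (hν : IsHolomorphicOneForm ν)
    (hγ : IsOrientedThimble f a θ γ) :
    ∃ (J : ℝ → ℂ) (E : ℂ → ℂ) (r : ℝ), 0 < r ∧ DifferentiableOn ℂ E (ball 0 r) ∧
      (∀ v, E (-v) = E v) ∧
      (∀ t : ℝ, 0 < t → t < r ^ 2 → J t = E (√t : ℝ) / (√t : ℝ)) ∧
      (∀ t : ℝ, 0 < t → ∃ ψ : ℂ → ℂ, AnalyticAt ℂ ψ t ∧ ∀ᶠ t' : ℝ in 𝓝 t, J t' = ψ t') ∧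
      ∀ z, ThimbleIntegrable f ν γ z →
        IntegrableOn (fun t : ℝ => exp (-(z * exp (θ * I) * t)) * J t) (Ioi 0) ∧
        thimbleIntegral f ν γ z =
          exp (-(f a * z)) * exp (θ * I) * halfLineLaplace J (z * exp (θ * I)) := by
  obtain ⟨h, hh⟩ := hγ.exists_height
  obtain ⟨h', hd, hne, hvel⟩ := exists_hasStrictDerivAt_height hf hγ hh
  obtain ⟨κ, hκ, hbr⟩ := exists_formRatio_branches hf hν hγ hh
  obtain ⟨r₀, hr₀, hbr⟩ := Metric.eventually_nhds_iff.1 hbr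
  obtain ⟨r₁, hr₁, hκr⟩ := Metric.eventually_nhds_iff_ball.1 hκ.eventually_analyticAt
  set u : ℂ := exp (θ * I) with hu
  have h0 : h 0 = 0 := by
    have := (hh 0).2
    rw [hγ.map_zero] at this
    simpa [hu] using this
  have hloc : ∀ s, s ≠ 0 → ∃ ψ : ℂ → ℂ, AnalyticAt ℂ ψ (h s) ∧
      ∀ᶠ s' in 𝓝 s, formRatio f ν (γ s') = ψ (h s') := fun s hs => by
    obtain ⟨ψ, hψ, hev⟩ := exists_formRatio_eq_comp hf hν (hγ.not_isCriticalPoint hs)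
    refine ⟨fun ζ => ψ (f a + ζ * u), AnalyticAt.comp (by rw [← (hh s).2]; exact hψ)
      (analyticAt_const.add (analyticAt_id.mul analyticAt_const)), ?_⟩
    filter_upwards [hγ.contMDiff.continuous.continuousAt.eventually hev] with s' hs'
    rw [hs', (hh s').2]
  obtain ⟨G₁, hG₁, hG₁loc, ⟨η₁, hη₁, hG₁P⟩, hT₁⟩ := exists_reparametrization
    (q := fun s => formRatio f ν (γ s)) (P := fun t => κ (√t : ℝ) / (√t : ℝ)) hd h0
    (fun s => (hh s).1) (fun s hs => hne s hs.ne') (tendsto_height hh hγ.tendsto_future)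
    (fun s hs => hloc s hs.ne') hr₀
    (fun s hs hsr => (hbr (by simpa [abs_of_pos hs] using hsr)).1 hs)
  obtain ⟨G₂, hG₂, hG₂loc, ⟨η₂, hη₂, hG₂P⟩, hT₂⟩ := exists_reparametrization
    (h := fun s => h (-s)) (h' := fun s => -h' (-s))
    (q := fun s => formRatio f ν (γ (-s))) (P := fun t => κ (-(√t : ℝ)) / -(√t : ℝ))
    (fun s => by
      have := (hd (-s)).comp s (hasStrictDerivAt_neg s)
      rw [mul_neg, mul_one] at this
      exact this) (by simpa using h0)
    (fun s => (hh _).1) (fun s hs => neg_ne_zero.2 (hne _ (neg_ne_zero.2 hs.ne')))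
    ((tendsto_height hh hγ.tendsto_past).comp tendsto_neg_atTop_atBot)
    (fun s hs => by
      obtain ⟨ψ, hψ, hev⟩ := hloc (-s) (neg_ne_zero.2 hs.ne')
      exact ⟨ψ, hψ, continuous_neg.continuousAt.eventually hev⟩) hr₀
    (fun s hs hsr => (hbr (by simpa [abs_of_pos hs] using hsr)).2 (neg_lt_zero.2 hs))
  -- The past half is traversed towards `a`, whence the minus sign; `κ(v)/v - κ(-v)/(-v) = (κ(v) +
  -- κ(-v))/v` makes the numerator even. The radius uses `√η` because `t = v²`.
  refine ⟨fun t => G₁ t - G₂ t, fun v => κ v + κ (-v), min r₁ (min √η₁ √η₂),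
    lt_min hr₁ (lt_min (Real.sqrt_pos.2 hη₁) (Real.sqrt_pos.2 hη₂)), fun v hv => ?_,
    fun v => by simp only [neg_neg, add_comm], fun t ht htr => ?_, fun t ht => ?_, fun z hz => ?_⟩
  · have hv' : v ∈ ball (0 : ℂ) r₁ := ball_subset_ball (min_le_left _ _) hv
    have h1 := (hκr v hv').differentiableAt
    have h2 := (hκr (-v) (by simpa using hv')).differentiableAt
    exact (h1.add (h2.comp v (differentiable_id.neg v))).differentiableWithinAt
  · have hrt : ∀ {η : ℝ}, 0 < η → min r₁ (min √η₁ √η₂) ≤ √η → t < η := fun hη hle => by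
      exact htr.trans_le ((Real.le_sqrt' (lt_min hr₁ (by positivity))).1 hle)
    simp only
    rw [hG₁P t ht (hrt hη₁ ((min_le_right _ _).trans (min_le_left _ _))),
      hG₂P t ht (hrt hη₂ ((min_le_right _ _).trans (min_le_right _ _)))]
    ring
  · obtain ⟨ψ₁, hψ₁, he₁⟩ := hG₁loc t ht
    obtain ⟨ψ₂, hψ₂, he₂⟩ := hG₂loc t ht
    refine ⟨fun ζ => ψ₁ ζ - ψ₂ ζ, hψ₁.sub hψ₂, ?_⟩
    filter_upwards [he₁, he₂] with t' h1 h2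
    rw [h1, h2]
  · set T := thimbleIntegrand f ν γ z with hT
    set K : ℂ := exp (-(f a * z)) * u with hK
    have hK0 : K ≠ 0 := mul_ne_zero (exp_ne_zero _) (exp_ne_zero _)
    have hTs : ∀ s, s ≠ 0 →
        T s = K * (h' s * (exp (-(z * u * h s)) * formRatio f ν (γ s))) := fun s hs => by
      change exp (-(z * f (γ s))) * formAt ν (γ s) (complexVelocity γ s) = _
      have he : exp (-(z * (f a + h s * u))) = exp (-(f a * z)) * exp (-(z * u * h s)) := by
        rw [← exp_add]; ring_nf
      rw [formAt_eq_formRatio_mul (hγ.not_isCriticalPoint hs), hvel, (hh s).2, he, hK]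
      ring
    have e₁ : EqOn T (fun s => K * (h' s • (exp (-(z * u * h s)) * G₁ (h s)))) (Ioi 0) :=
      fun s hs => by
        rw [hTs s (ne_of_gt hs)]
        simp only [hG₁ s hs, real_smul]
    -- The derivative of the reversed height is `-h' (-s)`, which accounts for the constant `-K`.
    have e₂ : EqOn (fun s => T (-s))
        (fun s => -K * ((-h' (-s)) • (exp (-(z * u * h (-s))) * G₂ (h (-s))))) (Ioi 0) :=
      fun s hs => by
        simp only [hTs (-s) (neg_ne_zero.2 (ne_of_gt hs)), hG₂ s hs, real_smul]
        push_cast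
        ring
    have hz : Integrable T := hz
    have hcancel : ∀ {K : ℂ} (_ : K ≠ 0) {p : ℝ → ℂ}, IntegrableOn (fun s => K * p s) (Ioi 0) →
        IntegrableOn p (Ioi 0) := fun {K} hK p hp => by
      have := Integrable.const_mul hp K⁻¹
      simp only [inv_mul_cancel_left₀ hK] at this
      exact this
    have i₁ := (hT₁ fun t => exp (-(z * u * t)) * G₁ t).1.2
      (hcancel hK0 ((integrableOn_congr_fun e₁ measurableSet_Ioi).1 hz.integrableOn))
    have i₂ := (hT₂ fun t => exp (-(z * u * t)) * G₂ t).1.2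
      (hcancel (neg_ne_zero.2 hK0)
        ((integrableOn_congr_fun e₂ measurableSet_Ioi).1 hz.comp_neg.integrableOn))
    refine ⟨?_, ?_⟩
    · simp only [mul_sub]
      exact i₁.sub i₂
    · have hsplit : ∫ s, T s = (∫ s in Ioi (0 : ℝ), T (-s)) + ∫ s in Ioi (0 : ℝ), T s := by
        rw [integral_comp_neg_Ioi, neg_zero,
          intervalIntegral.integral_Iic_add_Ioi hz.integrableOn hz.integrableOn]
      rw [thimbleIntegral, ← hT, hsplit, setIntegral_congr_fun measurableSet_Ioi e₁,
        setIntegral_congr_fun measurableSet_Ioi e₂, integral_const_mul, integral_const_mul,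
        ← (hT₁ fun t => exp (-(z * u * t)) * G₁ t).2,
        ← (hT₂ fun t => exp (-(z * u * t)) * G₂ t).2, halfLineLaplace]
      simp only [mul_sub]
      rw [integral_sub i₁ i₂]
      ring

end Manifold

end Thimble

end

theorem theorem1p9 {X : Type*} [TopologicalSpace X] [T2Space X] [ChartedSpace ℂ X]
    [IsManifold 𝓘(ℂ) 1 X]
    (f : X → ℂ) (hf : MDifferentiable 𝓘(ℂ) 𝓘(ℂ) f)
    (hcrit : ∀ x, Thimble.IsCriticalPoint f x → Thimble.IsNondegenerateCriticalPoint f x)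
    (ν : (x : X) → TangentSpace 𝓘(ℂ) x →L[ℂ] ℂ) (hν : Thimble.IsHolomorphicOneForm ν)
    (a : X) (θ : ℝ) (γ : ℝ → X) (hγ : Thimble.IsOrientedThimble f a θ γ)
    (hconv : ∃ z₀ : ℂ, Thimble.ThimbleIntegrable f ν γ z₀) :
    Thimble.IsBorelRegular {z : ℂ | Thimble.ThimbleIntegrable f ν γ z}
      (Thimble.thimbleIntegral f ν γ) θ (f a) (1 / 2) := by
  obtain ⟨J, E, r, hr, hE, heven, hJ₀, hJ, hrep⟩ := Thimble.exists_laplace_representation hf hν hγ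
  exact Thimble.isBorelRegular_of_laplace hr hE heven hJ₀ hJ hconv
    (fun z hz z' hzz' => Thimble.ThimbleIntegrable.mono_re hf hγ hz hzz')
    (fun z hz => (hrep z hz).1) fun z hz => (hrep z hz).2
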